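/- Let $n\ge 1$ and let $K,L\subset\mathbb R^n$ be convex bodies (compact convex sets) containing the origin in their interiors. For a convex body $K$ write $h_K(u)=\max_{x\in K}\langle x,u\rangle$ ($u\in S^{n-1}$) for its support function, $V_n(K)$ for its volume, and $S_K$ for its surface area measure, i.e. for Borel $\omega\subset S^{n-1}$, $S_K(\omega)=\mathcal H^{n-1}(\nu_K^{-1}(\omega))$, where the Gauss map $\nu_K$ sends each boundary point of $K$ having a unique outer unit normal vector to that vector. For $s\in\mathbb R$ let $$V_s(K,L)=\frac1n\int_{S^{n-1}}h_L(u)^s\,h_K(u)^{1-s}\,dS_K(u),$$ and for a continuous $\varphi:[0,\infty)\to[0,\infty)$ let $$V_\varphi(K,L)=\frac1n\int_{S^{n-1}}\varphi\!\left(\frac{h_L(u)}{h_K(u)}\right)h_K(u)\,dS_K(u)$$ be the Orlicz $\varphi$-mixed volume. Let $\varphi_1,\varphi_2:[0,\infty)\to[0,\infty)$ be continuous, strictly increasing and convex, with $\varphi_i(0)=0$, $\varphi_i(1)=1$ and $\lim_{t\to\infty}\varphi_i(t)=\infty$ for $i=1,2$. Then: (a) the left derivative $(\varphi_1)'_l(1)$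 exists and is positive; (b) for every $\varepsilon>0$ there is exactly one convex body $K+_{\varphi,\varepsilon}L$ containing the origin in its interior such that, for all $u\in S^{n-1}$, $$\varphi_1\!\left(\frac{h_K(u)}{h_{K+_{\varphi,\varepsilon}L}(u)}\right)+\varepsilon\,\varphi_2\!\left(\frac{h_L(u)}{h_{K+_{\varphi,\varepsilon}L}(u)}\right)=1;$$ (c) for every real $s\ne0$, the integrals defining $V_{\varphi_2}(K,L)$ and $V_s(K,K+_{\varphi,\varepsilon}L)$ ($\varepsilon>0$) converge, the limit below exists, and $$(\varphi_1)'_l(1)\,\lim_{\varepsilon\to0^+}\frac{V_s(K,K+_{\varphi,\varepsilon}L)-V_n(K)}{s\,\varepsilon}=V_{\varphi_2}(K,L).$$ -/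

import Mathlib

open MeasureTheory Set Filter Topology

/-- Euclidean space `ℝⁿ`. -/
abbrev E (n : ℕ) : Type := EuclideanSpace ℝ (Fin n)

/-- The unit sphere `S^{n-1}` of `ℝⁿ`. -/
abbrev USphere (n : ℕ) : Type := ↥(Metric.sphere (0 : E n) 1)

/-- The support function `h_K(u) = max_{x ∈ K} ⟨x, u⟩` on the unit sphere. -/
noncomputable def supportFn {n : ℕ} (K : ConvexBody (E n)) (u : USphere n) : ℝ :=
  sSup ((fun x : E n => inner ℝ x (u : E n)) '' (K : Set (E n)))

/-- The `n`-dimensional volume `V_n(K)`. -/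
noncomputable def bodyVolume {n : ℕ} (K : ConvexBody (E n)) : ℝ :=
  volume.real (K : Set (E n))

/-- `u` is an outer unit normal vector of `K` at the point `x`. -/
def IsOuterNormal {n : ℕ} (K : ConvexBody (E n)) (x : E n) (u : USphere n) : Prop :=
  ∀ y ∈ K, inner ℝ y (u : E n) ≤ inner ℝ x (u : E n)

/-- The regular boundary points of `K`: those with exactly one outer unit normal vector. -/
def regularBoundary {n : ℕ} (K : ConvexBody (E n)) : Set (E n) :=
  {x | x ∈ frontier (K : Set (E n)) ∧ ∃! u : USphere n, IsOuterNormal K x u}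

/-- The Gauss map `ν_K`, sending a regular boundary point to its outer unit normal vector. -/
noncomputable def gaussMap {n : ℕ} (K : ConvexBody (E n)) (x : ↥(regularBoundary K)) :
    USphere n :=
  x.2.2.choose

/-- The surface area measure `S_K` on `S^{n-1}`: the image under the Gauss map of the
`(n-1)`-dimensional Hausdorff measure (normalized to agree with Lebesgue measure on `ℝ^{n-1}`)
on the regular boundary points. -/
noncomputable def surfaceAreaMeasure {n : ℕ} (K : ConvexBody (E n)) : Measure (USphere n) :=
  Measure.map (gaussMap K) (Measure.euclideanHausdorffMeasure (n - 1))

theorem gaussMap_eq_iff {n : ℕ} (K : ConvexBody (E n)) (x : ↥(regularBoundary K))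
    (u : USphere n) : gaussMap K x = u ↔ IsOuterNormal K x u := by
  constructor
  · rintro rfl
    exact x.2.2.choose_spec.1
  · intro h
    exact (x.2.2.choose_spec.2 u h).symm

theorem continuous_gaussMap {n : ℕ} (K : ConvexBody (E n)) : Continuous (gaussMap K) := by
  rw [continuous_iff_isClosed]
  intro C hC
  have hG : IsClosed {p : ↥(regularBoundary K) × USphere n | IsOuterNormal K p.1 p.2} := by
    simp only [IsOuterNormal, ofPred_forall]
    refine isClosed_iInter fun y => isClosed_iInter fun _ => ?_
    exact isClosed_le (by fun_prop) (by fun_prop)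
  have h := isClosedMap_fst_of_compactSpace _ (hG.inter (hC.preimage continuous_snd))
  convert h using 1
  ext x
  simp only [mem_preimage, mem_image, mem_inter_iff, mem_ofPred_eq, Prod.exists]
  constructor
  · intro hx
    exact ⟨x, gaussMap K x, ⟨(gaussMap_eq_iff K x _).1 rfl, hx⟩, rfl⟩
  · rintro ⟨a, b, ⟨h1, h2⟩, rfl⟩
    rwa [(gaussMap_eq_iff K a b).2 h1]

/-- `S_K(ω)` is the Hausdorff measure of the set of boundary points whose outer unit normal
vector is unique and lies in `ω`. -/
theorem surfaceAreaMeasure_apply {n : ℕ} (K : ConvexBody (E n)) {ω : Set (USphere n)}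
    (hω : MeasurableSet ω) :
    surfaceAreaMeasure K ω = (Measure.euclideanHausdorffMeasure (n - 1) : Measure (E n))
      {x | x ∈ regularBoundary K ∧ ∃ u ∈ ω, IsOuterNormal K x u} := by
  rw [surfaceAreaMeasure, Measure.map_apply (continuous_gaussMap K).measurable hω,
    ← isometry_subtype_coe.euclideanHausdorffMeasure_image]
  congr 1
  ext x
  simp only [mem_image, mem_preimage, mem_ofPred_eq]
  constructor
  · rintro ⟨y, hy, rfl⟩
    exact ⟨y.2, _, hy, (gaussMap_eq_iff K y _).1 rfl⟩
  · rintro ⟨hx, u, hu, hn⟩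
    exact ⟨⟨x, hx⟩, by rwa [(gaussMap_eq_iff K ⟨x, hx⟩ u).2 hn], rfl⟩

/-- The integrand `h_L^s h_K^{1-s}` of the `L_s` mixed volume. -/
noncomputable def mixedIntegrand {n : ℕ} (s : ℝ) (K L : ConvexBody (E n)) (u : USphere n) : ℝ :=
  supportFn L u ^ s * supportFn K u ^ (1 - s)

/-- The `L_s` mixed volume `V_s(K, L) = (1/n) ∫ h_L^s h_K^{1-s} dS_K`. -/
noncomputable def mixedVolume {n : ℕ} (s : ℝ) (K L : ConvexBody (E n)) : ℝ :=
  (1 / (n : ℝ)) * ∫ u, mixedIntegrand s K L u ∂(surfaceAreaMeasure K)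

/-- The integrand `φ(h_L / h_K) h_K` of the Orlicz `φ`-mixed volume. -/
noncomputable def orliczIntegrand {n : ℕ} (φ : ℝ → ℝ) (K L : ConvexBody (E n))
    (u : USphere n) : ℝ :=
  φ (supportFn L u / supportFn K u) * supportFn K u

/-- The Orlicz `φ`-mixed volume `V_φ(K, L) = (1/n) ∫ φ(h_L / h_K) h_K dS_K`. -/
noncomputable def orliczMixedVolume {n : ℕ} (φ : ℝ → ℝ) (K L : ConvexBody (E n)) : ℝ :=
  (1 / (n : ℝ)) * ∫ u, orliczIntegrand φ K L u ∂(surfaceAreaMeasure K)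

/-- The class `Φ₁` of continuous, strictly increasing `φ : [0, ∞) → [0, ∞)` with `φ(0) = 0` and
`φ(t) → ∞` as `t → ∞`. A function on `[0, ∞)` is represented by a function on `ℝ` whose values
at negative arguments play no role. -/
structure MemPhi (φ : ℝ → ℝ) : Prop where
  mapsTo : MapsTo φ (Ici 0) (Ici 0)
  continuousOn : ContinuousOn φ (Ici 0)
  strictMonoOn : StrictMonoOn φ (Ici 0)
  map_zero : φ 0 = 0
  tendsto_atTop : Tendsto φ atTop atTop

/-- `M` is the linear Orlicz combination `K +_{φ,ε} L`: a convex body containing the origin in its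
interior whose support function solves `φ₁(h_K / h_M) + ε φ₂(h_L / h_M) = 1` on the sphere. -/
def IsOrliczCombination {n : ℕ} (φ₁ φ₂ : ℝ → ℝ) (ε : ℝ) (K L M : ConvexBody (E n)) : Prop :=
  (0 : E n) ∈ interior (M : Set (E n)) ∧
    ∀ u : USphere n,
      φ₁ (supportFn K u / supportFn M u) + ε * φ₂ (supportFn L u / supportFn M u) = 1

/-- The left derivative `φ'_l(t)`. -/
noncomputable def leftDeriv (φ : ℝ → ℝ) (t : ℝ) : ℝ := derivWithin φ (Iio t) t

/-! Write `a = h_K(u)`, `b = h_L(u)`, `c = h_M(u)` with `M = K +_{φ,ε} L`, and `t = a / c`. Then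
`c^s a^(1-s) = a t^(-s)`, and the defining equation reads `1 - φ₁(t) = ε φ₂(b / c)`. Hence `(c^s
a^(1-s) - a) / (s ε)` is `-a/s` times the difference quotient of `t^(-s)` at `1`, times `φ₂(b / c)`,
divided by the difference quotient of `φ₁` at `1`. Since `t` increases to `1` from below only, the
left derivative of `φ₁` appears and the pointwise limit is `φ₂(b / a) a / (φ₁)'_l(1)`
(`tendsto_orlicz_variation`). Convexity gives `φ₁(t) ≤ t`, so `1 - t ≤ ε φ₂(b / a)` uniformly in
`u`, and dominated convergence applies.

To turn this into a statement about `V_n(K)` one needs `n V_n(K) = ∫ h_K dS_K` and finiteness of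
`S_K`. Both come from comparing, on the regular boundary, the cone measure with `h_K(ν_K) dℋ^{n-1}`.
The Gauss map is continuous there, so near each point the central projection onto the tangent
hyperplane is almost an isometry, and cones over pieces of a hyperplane have explicit volume. The
errors are powers of an arbitrary `p > 1`. Rademacher's theorem for the gauge shows that the
irregular part carries no volume.

The body `M` is the polar of `D = {x | φ₁(h_K(x)) + ε φ₂(h_L(x)) ≤ 1}`: its support function is the
gauge of `D`, and the defining equation says that `u / h_M(u)` lies on the boundary of `D`. -/

/-- The support function `h_K(x) = max_{y ∈ K} ⟨y, x⟩` on the whole space. -/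
noncomputable def supportFnExt {n : ℕ} (K : ConvexBody (E n)) (x : E n) : ℝ :=
  sSup ((fun y : E n => inner ℝ y x) '' (K : Set (E n)))

/-! ### Support functions and outer normals. -/

section SupportFunction

variable {n : ℕ} (K : ConvexBody (E n))

theorem exists_inner_eq_supportFnExt (x : E n) : ∃ y ∈ K, inner ℝ y x = supportFnExt K x := by
  obtain ⟨y, hy, h⟩ := K.isCompact.exists_sSup_image_eq K.nonempty
    (f := fun y : E n => inner ℝ y x) (by fun_prop)
  exact ⟨y, hy, h.symm⟩

theorem inner_le_supportFnExt {y : E n} (hy : y ∈ K) (x : E n) :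
    inner ℝ y x ≤ supportFnExt K x :=
  le_csSup (K.isCompact.bddAbove_image (f := fun y : E n => inner ℝ y x) (by fun_prop))
    ⟨y, hy, rfl⟩

theorem supportFnExt_le {x : E n} {c : ℝ} (h : ∀ y ∈ K, inner ℝ y x ≤ c) :
    supportFnExt K x ≤ c := by
  obtain ⟨y, hy, e⟩ := exists_inner_eq_supportFnExt K x
  exact e ▸ h y hy

theorem supportFnExt_add_le (x y : E n) :
    supportFnExt K (x + y) ≤ supportFnExt K x + supportFnExt K y :=
  supportFnExt_le K fun z hz => by
    rw [inner_add_right]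
    exact add_le_add (inner_le_supportFnExt K hz x) (inner_le_supportFnExt K hz y)

theorem supportFnExt_smul {c : ℝ} (hc : 0 ≤ c) (x : E n) :
    supportFnExt K (c • x) = c * supportFnExt K x := by
  apply le_antisymm
  · refine supportFnExt_le K fun z hz => ?_
    rw [inner_smul_right]
    exact mul_le_mul_of_nonneg_left (inner_le_supportFnExt K hz x) hc
  · obtain ⟨y, hy, e⟩ := exists_inner_eq_supportFnExt K x
    rw [← e, ← inner_smul_right]
    exact inner_le_supportFnExt K hy _

theorem exists_forall_mul_norm_le_supportFnExt (hK : (0 : E n) ∈ interior (K : Set (E n))) :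
    ∃ r : ℝ, 0 < r ∧ ∀ x, r * ‖x‖ ≤ supportFnExt K x := by
  obtain ⟨r, hr, hb⟩ := Metric.nhds_basis_closedBall.mem_iff.1 (mem_interior_iff_mem_nhds.1 hK)
  refine ⟨r, hr, fun x => ?_⟩
  rcases eq_or_ne x 0 with rfl | hx
  · simpa using inner_le_supportFnExt K (interior_subset hK) (0 : E n)
  have hx' : ‖x‖ ≠ 0 := norm_ne_zero_iff.2 hx
  have h := inner_le_supportFnExt K (y := (r / ‖x‖) • x)
    (hb (by simp [norm_smul, abs_of_pos hr, hx'])) x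
  rw [real_inner_smul_left, real_inner_self_eq_norm_sq] at h
  convert h using 1
  field_simp

theorem exists_norm_le_and_supportFnExt_le :
    ∃ R : ℝ, 0 < R ∧ (∀ y ∈ K, ‖y‖ ≤ R) ∧ ∀ x, supportFnExt K x ≤ R * ‖x‖ := by
  obtain ⟨R, hR, h⟩ := K.isBounded.exists_pos_norm_le
  refine ⟨R, hR, h, fun x => supportFnExt_le K fun y hy => ?_⟩
  exact (real_inner_le_norm y x).trans (mul_le_mul_of_nonneg_right (h y hy) (norm_nonneg x))

theorem continuous_supportFnExt : Continuous (supportFnExt K) := by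
  obtain ⟨R, hR, -, h⟩ := exists_norm_le_and_supportFnExt_le K
  refine (LipschitzWith.of_le_add_mul ⟨R, hR.le⟩ fun x y => ?_).continuous
  have h1 := supportFnExt_add_le K y (x - y)
  rw [add_sub_cancel] at h1
  rw [dist_eq_norm]
  exact h1.trans (add_le_add_right (h _) _)

theorem continuous_supportFn : Continuous (supportFn K) :=
  (continuous_supportFnExt K).comp continuous_subtype_val

theorem supportFn_pos (hK : (0 : E n) ∈ interior (K : Set (E n))) (u : USphere n) :
    0 < supportFn K u := by
  obtain ⟨r, hr, h⟩ := exists_forall_mul_norm_le_supportFnExt K hK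
  have := h u
  rw [norm_eq_of_mem_sphere, mul_one] at this
  exact hr.trans_le this

theorem supportFnExt_nonneg (hK : (0 : E n) ∈ interior (K : Set (E n))) (x : E n) :
    0 ≤ supportFnExt K x := by
  simpa using inner_le_supportFnExt K (interior_subset hK) x

variable {K}

/-- The outer unit normal in the direction of a nonzero functional that is maximal at a point. -/
theorem exists_unit_direction {f : E n →L[ℝ] ℝ} (hf : f ≠ 0) :
    ∃ (u : USphere n) (c : ℝ), 0 < c ∧ ∀ y, f y = c * inner ℝ y (u : E n) := by
  set v := (InnerProductSpace.toDual ℝ (E n)).symm f with hv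
  have hv0 : v ≠ 0 := by simpa [hv] using hf
  have hn : ‖v‖ ≠ 0 := norm_ne_zero_iff.2 hv0
  refine ⟨⟨‖v‖⁻¹ • v, by simp [norm_smul, hn]⟩, ‖v‖, norm_pos_iff.2 hv0, fun y => ?_⟩
  rw [real_inner_smul_right, ← mul_assoc, mul_inv_cancel₀ hn, one_mul, real_inner_comm, hv,
    InnerProductSpace.toDual_symm_apply]

theorem mem_of_forall_inner_le_supportFn {x : E n}
    (h : ∀ u : USphere n, inner ℝ x (u : E n) ≤ supportFn K u) : x ∈ K := by
  by_contra hx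
  obtain ⟨f, a, h1, h2⟩ := geometric_hahn_banach_closed_point K.convex K.isClosed hx
  have hf : f ≠ 0 := by
    rintro rfl
    obtain ⟨y, hy⟩ := K.nonempty
    have := h1 y hy
    simp at this h2
    linarith
  obtain ⟨u, c, hc, hu⟩ := exists_unit_direction hf
  obtain ⟨y, hy, e⟩ := exists_inner_eq_supportFnExt K (u : E n)
  have h3 := (h1 y hy).trans h2
  rw [hu, hu, e] at h3
  exact absurd (h u) (not_le.2 (lt_of_mul_lt_mul_left h3 hc.le))

theorem eq_of_supportFn_eq {K M : ConvexBody (E n)} (h : supportFn K = supportFn M) : K = M := by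
  ext x
  constructor
  · intro hx
    refine mem_of_forall_inner_le_supportFn fun u => ?_
    rw [← h]
    exact inner_le_supportFnExt K hx u
  · intro hx
    refine mem_of_forall_inner_le_supportFn fun u => ?_
    rw [h]
    exact inner_le_supportFnExt M hx u

/-- Hahn–Banach separates the point from the open interior; the inequality extends to `K` because a
convex set with nonempty interior lies in the closure of its interior. -/
theorem exists_isOuterNormal (hK : (0 : E n) ∈ interior (K : Set (E n))) {x : E n}
    (hx : x ∈ frontier (K : Set (E n))) : ∃ u : USphere n, IsOuterNormal K x u := by
  obtain ⟨f, h1⟩ := geometric_hahn_banach_open_point K.convex.interior isOpen_interior hx.2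
  have hf : f ≠ 0 := by
    rintro rfl
    simpa using h1 0 hK
  obtain ⟨u, c, hc, hu⟩ := exists_unit_direction hf
  refine ⟨u, fun y hy => ?_⟩
  have hy' : y ∈ closure (interior (K : Set (E n))) := by
    rw [K.convex.closure_interior_eq_closure_of_nonempty_interior ⟨0, hK⟩]
    exact subset_closure hy
  refine closure_minimal (t := {y | inner ℝ y (u : E n) ≤ inner ℝ x (u : E n)}) ?_
    (isClosed_le (by fun_prop) (by fun_prop)) hy'
  intro z hz
  have := h1 z hz
  rw [hu, hu] at this
  exact (lt_of_mul_lt_mul_left this hc.le).le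

theorem IsOuterNormal.inner_eq {x : E n} {u : USphere n} (h : IsOuterNormal K x u) (hx : x ∈ K) :
    inner ℝ x (u : E n) = supportFn K u :=
  le_antisymm (inner_le_supportFnExt K hx _) (supportFnExt_le K h)

end SupportFunction

/-! ### Hausdorff measure of Lipschitz images, and volumes of flat cones. -/

section HausdorffLipschitz

variable {X Y : Type*} [EMetricSpace X] [MeasurableSpace X] [BorelSpace X]
  [EMetricSpace Y] [MeasurableSpace Y] [BorelSpace Y]

theorem LipschitzOnWith.euclideanHausdorffMeasure_image_le {C : NNReal} {f : X → Y} {s : Set X}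
    (h : LipschitzOnWith C f s) (d : ℕ) :
    (Measure.euclideanHausdorffMeasure d : Measure Y) (f '' s) ≤
      (C : ENNReal) ^ d * (Measure.euclideanHausdorffMeasure d : Measure X) s := by
  have h1 := h.hausdorffMeasure_image_le (d := d) (Nat.cast_nonneg d)
  rw [ENNReal.rpow_natCast] at h1
  simp only [Measure.euclideanHausdorffMeasure_def, Measure.smul_apply, ENNReal.smul_def,
    smul_eq_mul]
  rw [mul_left_comm]
  gcongr

end HausdorffLipschitz

open scoped Pointwise in
/-- The volume of a cone over a subset of a hyperplane at distance `h` from its apex. -/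
theorem volume_cone_over_hyperplane {n : ℕ} (hn : 1 ≤ n) {u : E n} (hu : ‖u‖ = 1) {h : ℝ}
    (hh : 0 < h) {B C : Set (E n)} (hB : B ⊆ {y | inner ℝ y u = h}) (hC : MeasurableSet C)
    (hCB : ∀ y, y ∈ C ↔ 0 < inner ℝ y u ∧ inner ℝ y u ≤ h ∧ (h / inner ℝ y u) • y ∈ B) :
    (n : ENNReal) * volume C =
      ENNReal.ofReal h * (Measure.euclideanHausdorffMeasure (n - 1) : Measure (E n)) B := by
  have hu0 : u ≠ 0 := by rintro rfl; simp at hu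
  have key := EuclideanGeometry.euclideanHausdorffMeasure_eq_lintegral (0 : E n) hu0 hC
  rw [InnerProductSpace.euclideanHausdorffMeasure_eq_volume, finrank_euclideanSpace_fin] at key
  -- Cavalieri: the slice at height `t` in `(0, h]` is the homothetic copy `(t / h) • B`, so its
  -- measure scales by `(t / h)^(n-1)`; integrating this factor gives `h / n`.
  have hslice : ∀ t : ℝ, (Measure.euclideanHausdorffMeasure (n - 1) : Measure (E n))
      (C ∩ AffineSubspace.mk' (t • u +ᵥ (0 : E n)) (Submodule.span ℝ {u})ᗮ) =
      (Ioc 0 h).indicator (fun t => ENNReal.ofReal ((t / h) ^ (n - 1)) *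
        (Measure.euclideanHausdorffMeasure (n - 1) : Measure (E n)) B) t := by
    intro t
    have hmem : ∀ y : E n, y ∈ (AffineSubspace.mk' (t • u +ᵥ (0 : E n))
        (Submodule.span ℝ {u})ᗮ : Set (E n)) ↔ inner ℝ y u = t := by
      intro y
      rw [SetLike.mem_coe, AffineSubspace.mem_mk', Submodule.mem_orthogonal_singleton_iff_inner_left]
      simp [inner_sub_left, inner_smul_left, hu, sub_eq_zero]
    by_cases ht : t ∈ Ioc 0 h
    · rw [indicator_of_mem ht]
      have hth : t / h ≠ 0 := (div_pos ht.1 hh).ne'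
      have : C ∩ AffineSubspace.mk' (t • u +ᵥ (0 : E n)) (Submodule.span ℝ {u})ᗮ =
          (t / h) • B := by
        ext y
        rw [mem_inter_iff, hmem, hCB, mem_smul_set_iff_inv_smul_mem₀ hth, inv_div]
        constructor
        · rintro ⟨⟨-, -, h3⟩, rfl⟩
          exact h3
        · intro hy
          have := hB hy
          simp only [mem_ofPred_eq, inner_smul_left] at this
          have hyt : inner ℝ y u = t := by
            have ht0 := ht.1.ne'
            simp at this
            field_simp at this
            exact this
          rw [hyt]
          exact ⟨⟨ht.1, ht.2, hy⟩, rfl⟩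
      rw [this, Measure.euclideanHausdorffMeasure_smul₀ _ hth, ENNReal.smul_def, smul_eq_mul]
      congr 1
      rw [ENNReal.ofReal_pow (div_pos ht.1 hh).le, ENNReal.coe_pow]
      congr 1
      rw [← Real.enorm_of_nonneg (div_pos ht.1 hh).le]
      rfl
    · rw [indicator_of_notMem ht]
      convert measure_empty
      · ext y
        rw [mem_inter_iff, hmem, hCB]
        simp only [mem_empty_iff_false, iff_false]
        rintro ⟨⟨h1, h2, -⟩, rfl⟩
        exact ht ⟨h1, h2⟩
      · infer_instance
  simp_rw [hslice] at key
  have hint : ∫⁻ t in Ioc 0 h, ENNReal.ofReal ((t / h) ^ (n - 1)) = ENNReal.ofReal (h / n) := by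
    rw [← ofReal_integral_eq_lintegral_ofReal, ← intervalIntegral.integral_of_le hh.le]
    · congr 1
      simp_rw [div_pow]
      rw [intervalIntegral.integral_div, integral_pow]
      obtain ⟨m, rfl⟩ : ∃ m, n = m + 1 := ⟨n - 1, by omega⟩
      simp
      field_simp
      rw [pow_succ]
    · exact (Continuous.integrableOn_Icc (by fun_prop)).mono_set Ioc_subset_Icc_self
    · filter_upwards [ae_restrict_mem measurableSet_Ioc] with t ht
      exact pow_nonneg (div_nonneg ht.1.le hh.le) _
  rw [lintegral_indicator measurableSet_Ioc, lintegral_mul_const _ (by fun_prop), hint] at key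
  rw [key, ← ofReal_norm, hu, ENNReal.ofReal_one, one_mul, ← mul_assoc]
  congr 1
  rw [← ENNReal.ofReal_natCast, ← ENNReal.ofReal_mul (by positivity)]
  congr 1
  field_simp

/-! ### Radial projection, regular boundary points and the cone measure. -/

section RadialProjection

variable {n : ℕ} (K : ConvexBody (E n))

/-- The radial projection onto the boundary of `K`. -/
noncomputable def radialProj (y : E n) : E n := (gauge (K : Set (E n)) y)⁻¹ • y

theorem radialProj_smul {c : ℝ} (hc : 0 < c) (y : E n) : radialProj K (c • y) = radialProj K y := by
  rw [radialProj, radialProj, gauge_smul_of_nonneg hc.le, smul_smul, smul_eq_mul, mul_inv,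
    mul_right_comm, inv_mul_cancel₀ hc.ne', one_mul]

/-- Points with two normals at distance at least `1 / (k + 1)` form the projection of a closed set
along a compact factor, hence a closed set; removing these countably many sets from the frontier
leaves the regular points. -/
theorem measurableSet_regularBoundary (hK : (0 : E n) ∈ interior (K : Set (E n))) :
    MeasurableSet (regularBoundary K) := by
  let F : ℕ → Set (E n × USphere n × USphere n) := fun k =>
    {p | IsOuterNormal K p.1 p.2.1 ∧ IsOuterNormal K p.1 p.2.2 ∧ 1 / ((k : ℝ) + 1) ≤ dist p.2.1 p.2.2}
  have hF : ∀ k, IsClosed (F k) := by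
    intro k
    simp only [F, IsOuterNormal, ofPred_and, ofPred_forall]
    refine (isClosed_iInter fun y => isClosed_iInter fun _ => isClosed_le (by fun_prop)
      (by fun_prop)).inter ((isClosed_iInter fun y => isClosed_iInter fun _ =>
        isClosed_le (by fun_prop) (by fun_prop)).inter (isClosed_le (by fun_prop) (by fun_prop)))
  have hP : ∀ k, IsClosed (Prod.fst '' F k) := fun k => isClosedMap_fst_of_compactSpace _ (hF k)
  have : regularBoundary K = frontier (K : Set (E n)) \ ⋃ k, Prod.fst '' F k := by
    ext x
    constructor
    · rintro ⟨hx, u, hu, huniq⟩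
      refine ⟨hx, ?_⟩
      rw [mem_iUnion]
      rintro ⟨k, ⟨y, v, w⟩, ⟨h1, h2, h3⟩, rfl⟩
      rw [huniq v h1, huniq w h2, dist_self] at h3
      exact absurd h3 (not_le.2 (by positivity))
    · rintro ⟨hx, hne⟩
      obtain ⟨u, hu⟩ := exists_isOuterNormal hK hx
      refine ⟨hx, u, hu, fun v hv => ?_⟩
      by_contra hvu
      obtain ⟨k, hk⟩ := exists_nat_one_div_lt (dist_pos.2 hvu)
      exact hne (mem_iUnion.2 ⟨k, (x, v, u), ⟨hv, hu, hk.le⟩, rfl⟩)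
  rw [this]
  exact isClosed_frontier.measurableSet.diff (MeasurableSet.iUnion fun k => (hP k).measurableSet)

variable {K}

theorem gauge_pos_of_ne_zero (hK : (0 : E n) ∈ interior (K : Set (E n))) {y : E n} (hy : y ≠ 0) :
    0 < gauge (K : Set (E n)) y :=
  (gauge_pos (absorbent_nhds_zero (mem_interior_iff_mem_nhds.1 hK))
    (NormedSpace.isVonNBounded_of_isBounded ℝ K.isBounded)).2 hy

theorem gauge_eq_one_iff_mem_frontier_body (hK : (0 : E n) ∈ interior (K : Set (E n))) {y : E n} :
    gauge (K : Set (E n)) y = 1 ↔ y ∈ frontier (K : Set (E n)) :=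
  gauge_eq_one_iff_mem_frontier K.convex (mem_interior_iff_mem_nhds.1 hK)

theorem gauge_le_one_iff_mem (hK : (0 : E n) ∈ interior (K : Set (E n))) {y : E n} :
    gauge (K : Set (E n)) y ≤ 1 ↔ y ∈ K := by
  rw [gauge_le_one_iff_mem_closure K.convex (mem_interior_iff_mem_nhds.1 hK),
    K.isClosed.closure_eq]
  rfl

theorem continuous_gauge_body (hK : (0 : E n) ∈ interior (K : Set (E n))) :
    Continuous (gauge (K : Set (E n))) :=
  continuous_gauge K.convex (mem_interior_iff_mem_nhds.1 hK)

theorem measurable_radialProj (hK : (0 : E n) ∈ interior (K : Set (E n))) :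
    Measurable (radialProj K) :=
  ((continuous_gauge_body hK).measurable.inv).smul measurable_id

theorem gauge_smul_radialProj (hK : (0 : E n) ∈ interior (K : Set (E n))) {y : E n} (hy : y ≠ 0) :
    gauge (K : Set (E n)) y • radialProj K y = y := by
  rw [radialProj, smul_smul, mul_inv_cancel₀ (gauge_pos_of_ne_zero hK hy).ne', one_smul]

theorem gauge_radialProj (hK : (0 : E n) ∈ interior (K : Set (E n))) {y : E n} (hy : y ≠ 0) :
    gauge (K : Set (E n)) (radialProj K y) = 1 := by
  rw [radialProj, gauge_smul_of_nonneg (inv_nonneg.2 (gauge_nonneg y)), smul_eq_mul,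
    inv_mul_cancel₀ (gauge_pos_of_ne_zero hK hy).ne']

theorem radialProj_eq_self (hK : (0 : E n) ∈ interior (K : Set (E n))) {y : E n}
    (hy : y ∈ frontier (K : Set (E n))) : radialProj K y = y := by
  rw [radialProj, (gauge_eq_one_iff_mem_frontier_body hK).2 hy, inv_one, one_smul]

/-- An outer normal is proportional to the gradient of the gauge. -/
theorem IsOuterNormal.smul_fderiv_gauge (hK : (0 : E n) ∈ interior (K : Set (E n))) {y : E n}
    (hy : y ≠ 0) (hd : DifferentiableAt ℝ (gauge (K : Set (E n))) y) {u : USphere n}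
    (hu : IsOuterNormal K (radialProj K y) u) :
    supportFn K u • fderiv ℝ (gauge (K : Set (E n))) y = innerSL ℝ (u : E n) := by
  have hmem : radialProj K y ∈ K := (gauge_le_one_iff_mem hK).1 (gauge_radialProj hK hy).le
  have hval := hu.inner_eq hmem
  -- The function `h_K(u) g_K(z) - ⟨u, z⟩`, with `g_K` the gauge, is nonnegative everywhere and
  -- vanishes at `y`, so its derivative at `y` is zero.
  have hmin : IsLocalMin
      (fun z => supportFn K u * gauge (K : Set (E n)) z - innerSL ℝ (u : E n) z) y := by
    have hy0 : supportFn K u * gauge (K : Set (E n)) y - innerSL ℝ (u : E n) y = 0 := by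
      rw [innerSL_apply_apply, real_inner_comm]
      nth_rewrite 2 [← gauge_smul_radialProj hK hy]
      rw [real_inner_smul_left, hval, mul_comm, sub_self]
    refine Eventually.of_forall fun z => ?_
    dsimp only
    rw [hy0, innerSL_apply_apply, real_inner_comm, sub_nonneg]
    rcases eq_or_ne z 0 with rfl | hz
    · simp
    have hz' : radialProj K z ∈ K := (gauge_le_one_iff_mem hK).1 (gauge_radialProj hK hz).le
    nth_rewrite 1 [← gauge_smul_radialProj hK hz]
    rw [real_inner_smul_left, mul_comm]
    exact mul_le_mul_of_nonneg_right (inner_le_supportFnExt K hz' _) (gauge_nonneg z)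
  have h0 := hmin.hasFDerivAt_eq_zero
    ((hd.hasFDerivAt.const_mul (supportFn K u)).sub (innerSL ℝ (u : E n)).hasFDerivAt)
  exact sub_eq_zero.1 h0

/-- Every normal at the projected point is a positive multiple of the gradient of the gauge; being
unit vectors, any two of them coincide. -/
theorem radialProj_mem_regularBoundary (hK : (0 : E n) ∈ interior (K : Set (E n))) {y : E n}
    (hy : y ≠ 0) (hd : DifferentiableAt ℝ (gauge (K : Set (E n))) y) :
    radialProj K y ∈ regularBoundary K := by
  have hfr := (gauge_eq_one_iff_mem_frontier_body hK).1 (gauge_radialProj hK hy)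
  obtain ⟨u, hu⟩ := exists_isOuterNormal hK hfr
  refine ⟨hfr, u, hu, fun v hv => ?_⟩
  have hnorm : ∀ w : USphere n, IsOuterNormal K (radialProj K y) w →
      supportFn K w * ‖fderiv ℝ (gauge (K : Set (E n))) y‖ = 1 := by
    intro w hw
    have := congrArg norm (hw.smul_fderiv_gauge hK hy hd)
    rwa [norm_smul, innerSL_apply_norm, norm_eq_of_mem_sphere,
      Real.norm_of_nonneg (supportFn_pos K hK w).le] at this
  have hne : ‖fderiv ℝ (gauge (K : Set (E n))) y‖ ≠ 0 := by
    intro h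
    have := hnorm u hu
    rw [h, mul_zero] at this
    exact zero_ne_one this
  have heq : supportFn K v = supportFn K u :=
    mul_right_cancel₀ hne ((hnorm v hv).trans (hnorm u hu).symm)
  have h1 := hv.smul_fderiv_gauge hK hy hd
  rw [heq, hu.smul_fderiv_gauge hK hy hd] at h1
  apply Subtype.ext
  refine ext_inner_right ℝ fun w => ?_
  exact (congrArg (fun f => f w) h1).symm

/-- The gauge is Lipschitz, so Rademacher's theorem makes it differentiable almost everywhere. -/
theorem ae_radialProj_mem_regularBoundary (hn : 1 ≤ n)
    (hK : (0 : E n) ∈ interior (K : Set (E n))) :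
    ∀ᵐ y : E n, radialProj K y ∈ regularBoundary K := by
  obtain ⟨C, hC⟩ := K.convex.lipschitz_gauge (mem_interior_iff_mem_nhds.1 hK)
  have : Nonempty (Fin n) := ⟨⟨0, hn⟩⟩
  filter_upwards [hC.ae_differentiableAt (μ := (volume : Measure (E n))),
    compl_mem_ae_iff.2 (measure_singleton (0 : E n))] with y hd hy
  exact radialProj_mem_regularBoundary hK hy hd

variable (K) in
/-- The volume of the cone with apex at the origin over a set of regular boundary points. -/
noncomputable def coneMeasure : Measure ↥(regularBoundary K) :=
  Measure.comap Subtype.val (Measure.map (radialProj K) (volume.restrict (K : Set (E n))))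

theorem coneMeasure_apply (hK : (0 : E n) ∈ interior (K : Set (E n)))
    {A : Set ↥(regularBoundary K)} (hA : MeasurableSet A) :
    coneMeasure K A = volume ((radialProj K ⁻¹' (Subtype.val '' A)) ∩ (K : Set (E n))) := by
  have hA' := (MeasurableEmbedding.subtype_coe
    (measurableSet_regularBoundary K hK)).measurableSet_image.2 hA
  rw [coneMeasure, (MeasurableEmbedding.subtype_coe
    (measurableSet_regularBoundary K hK)).comap_apply, Measure.map_apply (measurable_radialProj hK)
    hA', Measure.restrict_apply (measurable_radialProj hK hA')]

theorem coneMeasure_univ (hn : 1 ≤ n) (hK : (0 : E n) ∈ interior (K : Set (E n))) :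
    coneMeasure K univ = volume (K : Set (E n)) := by
  rw [coneMeasure_apply hK MeasurableSet.univ, image_univ, Subtype.range_coe]
  refine measure_congr ?_
  filter_upwards [ae_radialProj_mem_regularBoundary hn hK] with y hy
  change (_ ∧ _) = _
  exact eq_iff_iff.2 ⟨And.right, fun h => ⟨hy, h⟩⟩

end RadialProjection

/-! ### Almost isometric projection onto tangent hyperplanes. -/

section ConeVolume

variable {n : ℕ} {K : ConvexBody (E n)}

/-- Moving the normal `u` to a nearby `v` costs at most `δ ‖z - y‖`. Used in both directions, this
shows that heights over a tangent hyperplane vary slowly along the regular boundary. -/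
theorem inner_sub_le_of_dist_le {y z : E n} {u v : USphere n} {δ : ℝ}
    (hy : IsOuterNormal K y u) (hz : z ∈ K) (hd : dist u v ≤ δ) :
    inner ℝ (z - y) (v : E n) ≤ δ * ‖z - y‖ := by
  have h1 : inner ℝ (z - y) (u : E n) ≤ 0 := by
    rw [inner_sub_left]
    exact sub_nonpos.2 (hy z hz)
  have h2 : inner ℝ (z - y) ((v : E n) - u) ≤ ‖z - y‖ * ‖(v : E n) - u‖ := real_inner_le_norm _ _
  rw [inner_sub_right] at h2
  have h3 : ‖(v : E n) - u‖ ≤ δ := by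
    rw [← dist_eq_norm, dist_comm]
    exact hd
  nlinarith [norm_nonneg (z - y)]

theorem regularBoundary_subset : regularBoundary K ⊆ K := fun _ hx =>
  K.isClosed.frontier_subset hx.1

theorem isOuterNormal_gaussMap (x : ↥(regularBoundary K)) :
    IsOuterNormal K x (gaussMap K x) := (gaussMap_eq_iff K x _).1 rfl

variable (K) in
/-- The radial projection of boundary points onto the tangent hyperplane at `x`. -/
noncomputable def tangentProj (x y : ↥(regularBoundary K)) : E n :=
  (supportFn K (gaussMap K x) / inner ℝ (y : E n) (gaussMap K x : E n)) • (y : E n)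

theorem inner_gaussMap_self (x : ↥(regularBoundary K)) :
    inner ℝ (x : E n) (gaussMap K x : E n) = supportFn K (gaussMap K x) :=
  (isOuterNormal_gaussMap x).inner_eq (regularBoundary_subset x.2)

theorem eventually_div_le_inner (hK : (0 : E n) ∈ interior (K : Set (E n)))
    (x : ↥(regularBoundary K)) {p : ℝ} (hp : 1 < p) :
    ∀ᶠ y : ↥(regularBoundary K) in 𝓝 x,
      supportFn K (gaussMap K x) / p ≤ inner ℝ (y : E n) (gaussMap K x : E n) := by
  have hc : Continuous fun y : ↥(regularBoundary K) =>
      (inner ℝ (y : E n) (gaussMap K x : E n) : ℝ) := by fun_prop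
  refine (hc.tendsto x).eventually (Ici_mem_nhds ?_)
  rw [inner_gaussMap_self]
  exact div_lt_self (supportFn_pos K hK _) hp

/-- Near a regular boundary point the tangent projection is close to the identity. -/
theorem exists_nhds_tangentProj_sub (hK : (0 : E n) ∈ interior (K : Set (E n)))
    (x : ↥(regularBoundary K)) {η : ℝ} (hη : 0 < η) :
    ∃ U ∈ 𝓝 x, ∀ y ∈ U, ∀ z ∈ U,
      ‖(tangentProj K x y - tangentProj K x z) - ((y : E n) - z)‖ ≤ η * ‖(y : E n) - z‖ := by
  obtain ⟨R, hR, hKR, -⟩ := exists_norm_le_and_supportFnExt_le K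
  set u := gaussMap K x with hu
  set h := supportFn K u with hh
  have hpos : 0 < h := supportFn_pos K hK u
  -- With heights at least `h / 2` and `‖z‖ ≤ R`, the error from the variation of height is at most
  -- `4 R δ / h = η / 2` times `‖y - z‖`.
  set δ := η * h / (8 * R) with hδ
  have hδ0 : 0 < δ := by positivity
  have e1 : ∀ᶠ y : ↥(regularBoundary K) in 𝓝 x, h / 2 ≤ inner ℝ (y : E n) (u : E n) :=
    eventually_div_le_inner hK x one_lt_two
  have e2 : ∀ᶠ y : ↥(regularBoundary K) in 𝓝 x, dist (gaussMap K y) u ≤ δ :=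
    ((continuous_gaussMap K).tendsto x).eventually (Metric.closedBall_mem_nhds _ hδ0)
  have e3 : ∀ᶠ y : ↥(regularBoundary K) in 𝓝 x, |h / inner ℝ (y : E n) (u : E n) - 1| ≤ η / 2 := by
    have hx : inner ℝ (x : E n) (u : E n) = h := inner_gaussMap_self x
    have hc : Tendsto (fun y : ↥(regularBoundary K) =>
        |h / inner ℝ (y : E n) (u : E n) - 1|) (𝓝 x) (𝓝 |h / inner ℝ (x : E n) (u : E n) - 1|) := by
      refine Tendsto.abs (Tendsto.sub_const (Tendsto.div tendsto_const_nhds ?_ ?_) 1)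
      · exact Continuous.tendsto (by fun_prop) x
      · rw [hx]
        exact hpos.ne'
    rw [hx, div_self hpos.ne', sub_self, abs_zero] at hc
    exact hc.eventually (Iic_mem_nhds (by positivity))
  refine ⟨_, e1.and (e2.and e3), ?_⟩
  rintro y ⟨hy1, hy2, hy3⟩ z ⟨hz1, hz2, -⟩
  have hyz : |inner ℝ (z : E n) (u : E n) - inner ℝ (y : E n) (u : E n)| ≤ δ * ‖(y : E n) - z‖ := by
    have h1 := inner_sub_le_of_dist_le (isOuterNormal_gaussMap y)
      (regularBoundary_subset z.2) hy2
    have h2 := inner_sub_le_of_dist_le (isOuterNormal_gaussMap z)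
      (regularBoundary_subset y.2) hz2
    rw [inner_sub_left] at h1 h2
    rw [norm_sub_rev] at h1
    exact abs_le.2 ⟨by linarith, h1⟩
  set a := inner ℝ (y : E n) (u : E n) with ha
  set b := inner ℝ (z : E n) (u : E n) with hb
  have ha0 : 0 < a := lt_of_lt_of_le (by positivity) hy1
  have hb0 : 0 < b := lt_of_lt_of_le (by positivity) hz1
  have heq : (tangentProj K x y - tangentProj K x z) - ((y : E n) - z) =
      (h / a - 1) • ((y : E n) - z) + (h * (b - a) / (a * b)) • (z : E n) := by
    have hz' : h * (b - a) / (a * b) = h / a - h / b := by field_simp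
    rw [hz', tangentProj, tangentProj, ← hu, ← hh, ← ha, ← hb]
    module
  rw [heq]
  have hz4 : ‖(h * (b - a) / (a * b)) • (z : E n)‖ ≤ η / 2 * ‖(y : E n) - z‖ := by
    rw [norm_smul, Real.norm_eq_abs, abs_div, abs_mul, abs_of_pos hpos,
      abs_of_pos (mul_pos ha0 hb0)]
    have hab : h / 2 * (h / 2) ≤ a * b := mul_le_mul hy1 hz1 (by positivity) ha0.le
    calc h * |b - a| / (a * b) * ‖(z : E n)‖
        ≤ h * (δ * ‖(y : E n) - z‖) / (h / 2 * (h / 2)) * R := by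
          gcongr
          exact hKR _ (regularBoundary_subset z.2)
      _ = η / 2 * ‖(y : E n) - z‖ := by
          rw [hδ]
          field_simp
          ring
  calc _ ≤ ‖(h / a - 1) • ((y : E n) - z)‖ + ‖(h * (b - a) / (a * b)) • (z : E n)‖ :=
        norm_add_le _ _
    _ ≤ η / 2 * ‖(y : E n) - z‖ + η / 2 * ‖(y : E n) - z‖ := by
        refine add_le_add ?_ hz4
        rw [norm_smul]
        exact mul_le_mul_of_nonneg_right hy3 (norm_nonneg _)
    _ = _ := by ring

/-- Taking `η = 1 - 1 / p` gives the lower factor `1 - η = 1 / p` exactly, and `1 + η ≤ p` because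
`(p - 1)² / p ≥ 0`. -/
theorem exists_nhds_tangentProj_bilipschitz (hK : (0 : E n) ∈ interior (K : Set (E n)))
    (x : ↥(regularBoundary K)) {p : ℝ} (hp : 1 < p) :
    ∃ U ∈ 𝓝 x, ∀ y ∈ U, ∀ z ∈ U,
      dist (tangentProj K x y) (tangentProj K x z) ≤ p * dist y z ∧
      dist y z ≤ p * dist (tangentProj K x y) (tangentProj K x z) := by
  have hη : 0 < 1 - 1 / p := sub_pos.2 ((div_lt_one (by linarith)).2 hp)
  obtain ⟨U, hU, h⟩ := exists_nhds_tangentProj_sub hK x hη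
  refine ⟨U, hU, fun y hy z hz => ?_⟩
  have h1 := h y hy z hz
  have hp0 : 0 < p := by linarith
  have e : 1 - 1 / p ≤ p - 1 := by
    rw [sub_le_sub_iff, one_add_one_eq_two]
    have : (p - 1) ^ 2 / p = p + 1 / p - 2 := by field_simp; ring
    have h2 : 0 ≤ (p - 1) ^ 2 / p := by positivity
    linarith
  rw [Subtype.dist_eq y z, dist_eq_norm, dist_eq_norm]
  set w := tangentProj K x y - tangentProj K x z
  set v := (y : E n) - z
  have t1 : ‖w‖ ≤ ‖w - v‖ + ‖v‖ := by simpa using norm_add_le (w - v) v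
  have t2 : ‖v‖ ≤ ‖w‖ + ‖w - v‖ := by simpa using norm_sub_le w (w - v)
  have hv := norm_nonneg v
  constructor
  · nlinarith
  · have h3 : ‖v‖ / p ≤ ‖w‖ := by
      have : (1 - 1 / p) * ‖v‖ = ‖v‖ - ‖v‖ / p := by ring
      linarith
    rw [div_le_iff₀ hp0] at h3
    linarith

end ConeVolume

/-! ### Local comparison of cone measure with weighted Hausdorff measure. -/

section ConeVolumeComparison

variable {n : ℕ} {K : ConvexBody (E n)}

theorem radialProj_tangentProj (hK : (0 : E n) ∈ interior (K : Set (E n)))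
    {x y : ↥(regularBoundary K)} (hy : 0 < inner ℝ (y : E n) (gaussMap K x : E n)) :
    radialProj K (tangentProj K x y) = y := by
  rw [tangentProj, radialProj_smul K (div_pos (supportFn_pos K hK _) hy),
    radialProj_eq_self hK y.2.1]

theorem ne_zero_of_radialProj_mem (hK : (0 : E n) ∈ interior (K : Set (E n))) {y : E n}
    (hy : radialProj K y ∈ regularBoundary K) : y ≠ 0 := by
  rintro rfl
  rw [radialProj, smul_zero] at hy
  exact hy.1.2 hK

-- The flat cone `C` under the tangent hyperplane at `x` contains the part of `K` over `A` and lies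
-- in its dilate by `p`, which costs `p^n` in volume. Passing between `A` and its flat image `B`
-- costs `p^(n-1)`.
open scoped Pointwise in
theorem coneMeasure_comparison_hausdorff (hn : 1 ≤ n)
    (hK : (0 : E n) ∈ interior (K : Set (E n))) {x : ↥(regularBoundary K)} {p : ℝ} (hp : 1 < p)
    {A : Set ↥(regularBoundary K)} (hA : MeasurableSet A)
    (hlow : ∀ y ∈ A, supportFn K (gaussMap K x) / p ≤ inner ℝ (y : E n) (gaussMap K x : E n))
    (hlip : ∀ y ∈ A, ∀ z ∈ A,
      dist (tangentProj K x y) (tangentProj K x z) ≤ p * dist y z ∧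
      dist y z ≤ p * dist (tangentProj K x y) (tangentProj K x z)) :
    n * coneMeasure K A ≤ ENNReal.ofReal (supportFn K (gaussMap K x)) *
      (ENNReal.ofReal p ^ (n - 1) * Measure.euclideanHausdorffMeasure (n - 1) A) ∧
    ENNReal.ofReal (supportFn K (gaussMap K x)) * Measure.euclideanHausdorffMeasure (n - 1) A ≤
      ENNReal.ofReal p ^ (n - 1) * (ENNReal.ofReal p ^ n * (n * coneMeasure K A)) := by
  set u := gaussMap K x
  set h := supportFn K u
  have hh : 0 < h := supportFn_pos K hK u
  have hp0 : 0 < p := one_pos.trans hp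
  have hpos : ∀ y ∈ A, 0 < inner ℝ (y : E n) (u : E n) := fun y hy =>
    (div_pos hh hp0).trans_le (hlow y hy)
  set B := tangentProj K x '' A
  set S : Set (E n) := radialProj K ⁻¹' (Subtype.val '' A)
  have hA' : MeasurableSet (Subtype.val '' A : Set (E n)) := (MeasurableEmbedding.subtype_coe
    (measurableSet_regularBoundary K hK)).measurableSet_image.2 hA
  have hS : MeasurableSet S := measurable_radialProj hK hA'
  have hSne : ∀ y ∈ S, y ≠ 0 := by
    rintro y ⟨a, -, hay⟩
    exact ne_zero_of_radialProj_mem hK (hay ▸ a.2)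
  have hSinner : ∀ y ∈ S, ∃ a ∈ A, radialProj K y = a ∧
      inner ℝ y (u : E n) = gauge (K : Set (E n)) y * inner ℝ (a : E n) (u : E n) ∧
      gauge (K : Set (E n)) y • (a : E n) = y := by
    intro y hy
    have hy0 := hSne y hy
    obtain ⟨a, ha, hay⟩ := hy
    have e := gauge_smul_radialProj hK hy0
    rw [← hay] at e
    refine ⟨a, ha, hay.symm, ?_, e⟩
    rw [← real_inner_smul_left, e]
  set C : Set (E n) := {y | 0 < inner ℝ y (u : E n) ∧ inner ℝ y (u : E n) ≤ h} ∩ S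
  have hC : MeasurableSet C := by
    refine MeasurableSet.inter ?_ hS
    have hc : Continuous fun y : E n => (inner ℝ y (u : E n) : ℝ) := by fun_prop
    exact (measurableSet_lt measurable_const hc.measurable).inter
      (measurableSet_le hc.measurable measurable_const)
  have hBp : B ⊆ {y | inner ℝ y (u : E n) = h} := by
    rintro _ ⟨a, ha, rfl⟩
    have := (hpos a ha).ne'
    simp only [mem_ofPred_eq, tangentProj, real_inner_smul_left]
    exact div_mul_cancel₀ _ this
  have hCB : ∀ y, y ∈ C ↔ 0 < inner ℝ y (u : E n) ∧ inner ℝ y (u : E n) ≤ h ∧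
      (h / inner ℝ y (u : E n)) • y ∈ B := by
    intro y
    constructor
    · rintro ⟨⟨h1, h2⟩, hy⟩
      refine ⟨h1, h2, ?_⟩
      obtain ⟨a, ha, -, e1, e2⟩ := hSinner y hy
      refine ⟨a, ha, ?_⟩
      have hg := gauge_pos_of_ne_zero hK (hSne y hy)
      have ha0 := (hpos a ha).ne'
      rw [e1]
      nth_rewrite 2 [← e2]
      rw [smul_smul, tangentProj]
      congr 1
      change h / inner ℝ (a : E n) (u : E n) = _
      field_simp
    · rintro ⟨h1, h2, a, ha, e⟩
      refine ⟨⟨h1, h2⟩, a, ha, ?_⟩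
      have := congrArg (radialProj K) e
      rwa [radialProj_tangentProj hK (hpos a ha), radialProj_smul K (div_pos hh h1)] at this
  have hcone := volume_cone_over_hyperplane hn (norm_eq_of_mem_sphere u) hh hBp hC hCB
  have hvolA := coneMeasure_apply hK hA
  have hp_coe : ((Real.toNNReal p : NNReal) : ENNReal) = ENNReal.ofReal p := rfl
  have hp_real : ((Real.toNNReal p : NNReal) : ℝ) = p := Real.coe_toNNReal p hp0.le
  have hH1 : (Measure.euclideanHausdorffMeasure (n - 1) : Measure (E n)) B ≤
      ENNReal.ofReal p ^ (n - 1) * Measure.euclideanHausdorffMeasure (n - 1) A := by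
    refine LipschitzOnWith.euclideanHausdorffMeasure_image_le (C := Real.toNNReal p) ?_ (n - 1)
    refine LipschitzOnWith.of_dist_le_mul fun y hy z hz => ?_
    rw [hp_real]
    exact (hlip y hy z hz).1
  have hH2 : Measure.euclideanHausdorffMeasure (n - 1) A ≤ ENNReal.ofReal p ^ (n - 1) *
      (Measure.euclideanHausdorffMeasure (n - 1) : Measure (E n)) B := by
    -- On `B` the radial projection inverts the tangent projection, so the second Lipschitz bound
    -- applies to it.
    have e : (Subtype.val '' A : Set (E n)) = radialProj K '' B := by
      rw [image_image]
      exact image_congr fun a ha => (radialProj_tangentProj hK (hpos a ha)).symm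
    rw [← isometry_subtype_coe.euclideanHausdorffMeasure_image, e]
    refine LipschitzOnWith.euclideanHausdorffMeasure_image_le (C := Real.toNNReal p) ?_ (n - 1)
    refine LipschitzOnWith.of_dist_le_mul ?_
    rintro _ ⟨y, hy, rfl⟩ _ ⟨z, hz, rfl⟩
    rw [hp_real, radialProj_tangentProj hK (hpos y hy), radialProj_tangentProj hK (hpos z hz)]
    exact (hlip y hy z hz).2
  constructor
  · calc (n : ENNReal) * coneMeasure K A ≤ n * volume C := by
          rw [hvolA]
          gcongr
          rintro y ⟨hy, hyK⟩
          obtain ⟨a, ha, -, e1, -⟩ := hSinner y hy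
          refine ⟨⟨?_, inner_le_supportFnExt K hyK _⟩, hy⟩
          rw [e1]
          exact mul_pos (gauge_pos_of_ne_zero hK (hSne y hy)) (hpos a ha)
      _ = _ := hcone
      _ ≤ _ := by gcongr
  · calc _ ≤ ENNReal.ofReal h * (ENNReal.ofReal p ^ (n - 1) *
          (Measure.euclideanHausdorffMeasure (n - 1) : Measure (E n)) B) := by gcongr
      _ = ENNReal.ofReal p ^ (n - 1) * (n * volume C) := by rw [hcone]; ring
      _ ≤ ENNReal.ofReal p ^ (n - 1) * (n * (ENNReal.ofReal p ^ n * coneMeasure K A)) := by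
          gcongr
          -- For `y = g_K(y) a` with `a ∈ A`, the bounds `⟨y, u⟩ ≤ h` and `⟨a, u⟩ ≥ h / p` force
          -- `g_K(y) ≤ p`.
          have hsub : C ⊆ p • (S ∩ K) := by
            rintro y ⟨⟨h1, h2⟩, hy⟩
            rw [mem_smul_set_iff_inv_smul_mem₀ hp0.ne']
            refine ⟨?_, ?_⟩
            · simpa only [S, mem_preimage, radialProj_smul K (inv_pos.2 hp0)] using hy
            · obtain ⟨a, ha, -, e1, -⟩ := hSinner y hy
              refine (gauge_le_one_iff_mem hK).1 ?_
              rw [gauge_smul_of_nonneg (inv_nonneg.2 hp0.le), smul_eq_mul, inv_mul_le_one₀ hp0]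
              have h3 := hlow a ha
              rw [div_le_iff₀ hp0] at h3
              have h4 := hpos a ha
              rw [e1] at h2
              refine le_of_mul_le_mul_right ?_ h4
              linarith
          refine (measure_mono hsub).trans ?_
          rw [Measure.addHaar_smul, hvolA, finrank_euclideanSpace_fin, abs_of_pos (pow_pos hp0 n),
            ENNReal.ofReal_pow hp0.le]
      _ = _ := by ring

/-- By continuity `h_K(ν_K(y))` stays within a factor `p` of its value at `x`. This extra factor
turns `p^(n-1)` into `p^n`, and `p^(n-1) p^n` into `p^(2n)`. -/
theorem coneMeasure_comparison_local (hn : 1 ≤ n) (hK : (0 : E n) ∈ interior (K : Set (E n)))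
    (x : ↥(regularBoundary K)) {p : ℝ} (hp : 1 < p) :
    ∃ U ∈ 𝓝 x, ∀ A ⊆ U, MeasurableSet A →
      n * coneMeasure K A ≤ ENNReal.ofReal p ^ n *
        ∫⁻ y in A, ENNReal.ofReal (supportFn K (gaussMap K y))
          ∂(Measure.euclideanHausdorffMeasure (n - 1)) ∧
      ∫⁻ y in A, ENNReal.ofReal (supportFn K (gaussMap K y))
          ∂(Measure.euclideanHausdorffMeasure (n - 1)) ≤
        ENNReal.ofReal p ^ (2 * n) * (n * coneMeasure K A) := by
  obtain ⟨U, hU, hlip⟩ := exists_nhds_tangentProj_bilipschitz hK x hp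
  have hh : 0 < supportFn K (gaussMap K x) := supportFn_pos K hK _
  have hp0 : 0 < p := one_pos.trans hp
  have hcont : Continuous fun y => supportFn K (gaussMap K y) :=
    (continuous_supportFn K).comp (continuous_gaussMap K)
  have e1 := (hcont.tendsto x).eventually (Ici_mem_nhds (div_lt_self hh hp))
  have e2 := (hcont.tendsto x).eventually (Iic_mem_nhds (lt_mul_of_one_lt_left hh hp))
  refine ⟨_, (eventually_div_le_inner hK x hp).and (e1.and (e2.and hU)), fun A hAU hA => ?_⟩
  obtain ⟨h1, h2⟩ := coneMeasure_comparison_hausdorff hn hK hp hA (fun y hy => (hAU hy).1)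
    (fun y hy z hz => hlip y (hAU hy).2.2.2 z (hAU hz).2.2.2)
  set h := supportFn K (gaussMap K x)
  have hpn : ENNReal.ofReal p ^ n = ENNReal.ofReal p * ENNReal.ofReal p ^ (n - 1) := by
    rw [← pow_succ', Nat.sub_add_cancel hn]
  constructor
  · have hlow : ENNReal.ofReal (h / p) * Measure.euclideanHausdorffMeasure (n - 1) A ≤
        ∫⁻ y in A, ENNReal.ofReal (supportFn K (gaussMap K y))
          ∂(Measure.euclideanHausdorffMeasure (n - 1)) := by
      rw [← setLIntegral_const]
      exact setLIntegral_mono' hA fun y hy => ENNReal.ofReal_le_ofReal (hAU hy).2.1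
    refine h1.trans (le_trans (le_of_eq ?_) (mul_le_mul_right hlow _))
    have : ENNReal.ofReal h = ENNReal.ofReal p * ENNReal.ofReal (h / p) := by
      rw [← ENNReal.ofReal_mul hp0.le, mul_div_cancel₀ _ hp0.ne']
    rw [this, hpn]
    ring
  · have hup : ∫⁻ y in A, ENNReal.ofReal (supportFn K (gaussMap K y))
          ∂(Measure.euclideanHausdorffMeasure (n - 1)) ≤
        ENNReal.ofReal (p * h) * Measure.euclideanHausdorffMeasure (n - 1) A := by
      rw [← setLIntegral_const]
      exact setLIntegral_mono' hA fun y hy => ENNReal.ofReal_le_ofReal (hAU hy).2.2.1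
    refine hup.trans ?_
    rw [ENNReal.ofReal_mul hp0.le, mul_assoc]
    refine (mul_le_mul_right h2 _).trans (le_of_eq ?_)
    rw [two_mul, pow_add, hpn]
    ring

end ConeVolumeComparison

/-! ### From local to global inequalities of measures. -/

section Gluing

/-- An inequality of measures may be checked locally. -/
theorem measure_le_of_forall_nhds {X : Type*} [TopologicalSpace X] [SecondCountableTopology X]
    [MeasurableSpace X] [BorelSpace X] {μ ν : Measure X}
    (h : ∀ x, ∃ U ∈ 𝓝 x, ∀ A ⊆ U, MeasurableSet A → μ A ≤ ν A) : μ univ ≤ ν univ := by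
  choose U hU hle using h
  -- Second countability yields a countable subcover; made disjoint, it lets the local inequalities
  -- be summed.
  obtain ⟨s, hs, hcover⟩ := TopologicalSpace.countable_cover_nhds
    (f := fun x => interior (U x)) fun x => interior_mem_nhds.2 (hU x)
  rcases s.eq_empty_or_nonempty with rfl | hne
  · simp only [biUnion_empty] at hcover
    simp [← hcover]
  obtain ⟨f, rfl⟩ := hs.exists_eq_range hne
  rw [biUnion_range] at hcover
  have hm : ∀ i, MeasurableSet (disjointed (fun i => interior (U (f i))) i) := fun i =>
    MeasurableSet.disjointed (fun _ => isOpen_interior.measurableSet) i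
  rw [← hcover, ← iUnion_disjointed, measure_iUnion (disjoint_disjointed _) hm,
    measure_iUnion (disjoint_disjointed _) hm]
  exact ENNReal.tsum_le_tsum fun i =>
    hle _ _ ((disjointed_subset _ i).trans interior_subset) (hm i)

end Gluing

/-! ### The cone volume formula and finiteness of the surface area measure. -/

section ConeVolumeFormula

variable {n : ℕ} {K : ConvexBody (E n)}

theorem le_of_forall_one_lt_ofReal_pow_mul {a b : ENNReal} (m : ℕ)
    (h : ∀ p : ℝ, 1 < p → a ≤ ENNReal.ofReal p ^ m * b) : a ≤ b := by
  have h1 : Tendsto (fun p : ℝ => ENNReal.ofReal p ^ m) (𝓝[>] 1) (𝓝 1) := by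
    have : Continuous fun p : ℝ => ENNReal.ofReal p ^ m :=
      (ENNReal.continuous_pow m).comp ENNReal.continuous_ofReal
    simpa using (this.tendsto 1).mono_left nhdsWithin_le_nhds
  have h2 := ENNReal.Tendsto.mul_const (b := b) h1 (Or.inl one_ne_zero)
  rw [one_mul] at h2
  refine ge_of_tendsto h2 ?_
  filter_upwards [self_mem_nhdsWithin] with p hp using h p hp

/-- The cone volume formula `∫ h_K dS_K = n V_n(K)`. -/
theorem lintegral_supportFn_surfaceAreaMeasure (hn : 1 ≤ n)
    (hK : (0 : E n) ∈ interior (K : Set (E n))) :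
    ∫⁻ u, ENNReal.ofReal (supportFn K u) ∂(surfaceAreaMeasure K) =
      n * volume (K : Set (E n)) := by
  set H : Measure ↥(regularBoundary K) := Measure.euclideanHausdorffMeasure (n - 1)
  set f : ↥(regularBoundary K) → ENNReal := fun y => ENNReal.ofReal (supportFn K (gaussMap K y))
  have hmeas : Measurable f :=
    (((continuous_supportFn K).comp (continuous_gaussMap K)).measurable).ennreal_ofReal
  have hlhs : ∫⁻ u, ENNReal.ofReal (supportFn K u) ∂(surfaceAreaMeasure K) =
      H.withDensity f univ := by
    rw [surfaceAreaMeasure, lintegral_map (continuous_supportFn K).measurable.ennreal_ofReal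
      (continuous_gaussMap K).measurable, withDensity_apply _ MeasurableSet.univ,
      Measure.restrict_univ]
  have hrhs : (n : ENNReal) * volume (K : Set (E n)) = ((n : ENNReal) • coneMeasure K) univ := by
    rw [Measure.smul_apply, coneMeasure_univ hn hK, smul_eq_mul]
  rw [hlhs, hrhs]
  apply le_antisymm
  · refine le_of_forall_one_lt_ofReal_pow_mul (2 * n) fun p hp => ?_
    rw [← smul_eq_mul, ← Measure.smul_apply]
    refine measure_le_of_forall_nhds fun x => ?_
    obtain ⟨U, hU, h⟩ := coneMeasure_comparison_local hn hK x hp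
    refine ⟨U, hU, fun A hAU hA => ?_⟩
    rw [withDensity_apply _ hA]
    exact (h A hAU hA).2
  · refine le_of_forall_one_lt_ofReal_pow_mul n fun p hp => ?_
    rw [← smul_eq_mul (ENNReal.ofReal p ^ n), ← Measure.smul_apply (ENNReal.ofReal p ^ n)]
    refine measure_le_of_forall_nhds fun x => ?_
    obtain ⟨U, hU, h⟩ := coneMeasure_comparison_local hn hK x hp
    refine ⟨U, hU, fun A hAU hA => ?_⟩
    rw [Measure.smul_apply (ENNReal.ofReal p ^ n), withDensity_apply _ hA]
    exact (h A hAU hA).1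

/-- Since `h_K ≥ r > 0` on the sphere, the cone volume formula bounds the total mass by `n V_n(K) /
r`. -/
theorem isFiniteMeasure_surfaceAreaMeasure (hn : 1 ≤ n)
    (hK : (0 : E n) ∈ interior (K : Set (E n))) : IsFiniteMeasure (surfaceAreaMeasure K) := by
  obtain ⟨r, hr, h⟩ := exists_forall_mul_norm_le_supportFnExt K hK
  have h1 : ENNReal.ofReal r * surfaceAreaMeasure K univ ≤ n * volume (K : Set (E n)) := by
    rw [← lintegral_supportFn_surfaceAreaMeasure hn hK, ← lintegral_const]
    refine lintegral_mono fun u => ENNReal.ofReal_le_ofReal ?_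
    have := h u
    rwa [norm_eq_of_mem_sphere, mul_one] at this
  have h2 : (n : ENNReal) * volume (K : Set (E n)) < ⊤ :=
    ENNReal.mul_lt_top (ENNReal.natCast_lt_top n) K.isCompact.measure_lt_top
  refine ⟨lt_of_not_ge fun htop => ?_⟩
  rw [top_le_iff.1 htop, ENNReal.mul_top (ENNReal.ofReal_pos.2 hr).ne'] at h1
  exact absurd (h1.trans_lt h2) (lt_irrefl _)

/-- The cone volume formula `V_n(K) = (1/n) ∫ h_K dS_K`. -/
theorem bodyVolume_eq_integral_supportFn (hn : 1 ≤ n)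
    (hK : (0 : E n) ∈ interior (K : Set (E n))) :
    bodyVolume K = (1 / (n : ℝ)) * ∫ u, supportFn K u ∂(surfaceAreaMeasure K) := by
  rw [integral_eq_lintegral_of_nonneg_ae
    (Eventually.of_forall fun u => (supportFn_pos K hK u).le)
    (continuous_supportFn K).aestronglyMeasurable,
    lintegral_supportFn_surfaceAreaMeasure hn hK, ENNReal.toReal_mul, ENNReal.toReal_natCast,
    ← mul_assoc, one_div_mul_cancel (by positivity), one_mul]
  rfl

end ConeVolumeFormula

/-! ### Gauges as support functions of polar bodies. -/

section PolarBody

variable {n : ℕ}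

open scoped Pointwise in
/-- The gauge function of a bounded closed convex neighbourhood of the origin is the support
function of its polar body. -/
theorem exists_supportFnExt_eq_gauge {D : Set (E n)} (hc : Convex ℝ D) (hcl : IsClosed D)
    (h0 : D ∈ 𝓝 (0 : E n)) (hb : Bornology.IsBounded D) :
    ∃ M : ConvexBody (E n), (0 : E n) ∈ interior (M : Set (E n)) ∧
      ∀ x, supportFnExt M x = gauge D x := by
  obtain ⟨r, hr, hrD⟩ := Metric.nhds_basis_closedBall.mem_iff.1 h0
  obtain ⟨R, hR, hRD⟩ := hb.exists_pos_norm_le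
  have hclosed : IsClosed {y : E n | ∀ x ∈ D, inner ℝ y x ≤ 1} := by
    simp only [ofPred_forall]
    exact isClosed_iInter fun x => isClosed_iInter fun _ => isClosed_le (by fun_prop) (by fun_prop)
  have hbdd : Bornology.IsBounded {y : E n | ∀ x ∈ D, inner ℝ y x ≤ 1} := by
    refine isBounded_iff_forall_norm_le.2 ⟨1 / r, fun y hy => ?_⟩
    rcases eq_or_ne y 0 with rfl | hy0
    · rw [norm_zero]
      positivity
    have hn : ‖y‖ ≠ 0 := norm_ne_zero_iff.2 hy0
    have := hy ((r / ‖y‖) • y) (hrD (by simp [norm_smul, abs_of_pos hr, hn]))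
    rw [real_inner_smul_right, real_inner_self_eq_norm_sq] at this
    have e : r / ‖y‖ * ‖y‖ ^ 2 = ‖y‖ * r := by field_simp
    rwa [le_div_iff₀ hr, ← e]
  let M : ConvexBody (E n) :=
    { carrier := {y : E n | ∀ x ∈ D, inner ℝ y x ≤ 1}
      convex' := by
        intro y hy z hz a b ha hb' hab x hx
        rw [inner_add_left, real_inner_smul_left, real_inner_smul_left]
        nlinarith [hy x hx, hz x hx]
      isCompact' := Metric.isCompact_of_isClosed_isBounded hclosed hbdd
      nonempty' := ⟨0, fun x _ => by simp⟩ }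
  have hM : ∀ y, y ∈ M ↔ ∀ x ∈ D, inner ℝ y x ≤ 1 := fun y => Iff.rfl
  have hM0 : (0 : E n) ∈ interior (M : Set (E n)) := by
    rw [mem_interior_iff_mem_nhds]
    refine mem_of_superset (Metric.closedBall_mem_nhds 0 (inv_pos.2 hR)) fun y hy x hx => ?_
    rw [mem_closedBall_zero_iff] at hy
    calc inner ℝ y x ≤ ‖y‖ * ‖x‖ := real_inner_le_norm y x
      _ ≤ R⁻¹ * R := mul_le_mul hy (hRD x hx) (norm_nonneg x) (inv_pos.2 hR).le
      _ = 1 := inv_mul_cancel₀ hR.ne'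
  refine ⟨M, hM0, fun x => le_antisymm ?_ ?_⟩
  -- If the gauge of `x` is below `a`, then `x = b • z` with `z ∈ D` and `0 < b < a`, so `⟨y, x⟩ ≤ b
  -- < a` for `y` in the polar.
  · refine supportFnExt_le M fun y hy => le_of_forall_gt fun a ha => ?_
    obtain ⟨b, hb0, hba, z, hz, rfl⟩ := exists_lt_of_gauge_lt (absorbent_nhds_zero h0) ha
    simp only [real_inner_smul_right]
    nlinarith [(hM y).1 hy z hz]
  · by_contra hlt
    obtain ⟨a, ha1, ha2⟩ := exists_between (not_le.1 hlt)
    have ha0 : 0 < a := (supportFnExt_nonneg M hM0 x).trans_lt ha1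
    have hx : a⁻¹ • x ∉ D := fun hx => absurd
      (gauge_le_of_mem ha0.le ((mem_smul_set_iff_inv_smul_mem₀ ha0.ne' D x).2 hx)) (not_le.2 ha2)
    -- A functional separating `a⁻¹ • x` from `D`, normalized by its level `c > 0`, is a point of
    -- the polar whose value at `x` exceeds `a`.
    obtain ⟨f, c, h1, h2⟩ := geometric_hahn_banach_closed_point hc hcl hx
    have hc0 : 0 < c := by simpa using h1 0 (mem_of_mem_nhds h0)
    have hf : ∀ z, inner ℝ (c⁻¹ • (InnerProductSpace.toDual ℝ (E n)).symm f) z = c⁻¹ * f z := by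
      intro z
      rw [real_inner_smul_left, InnerProductSpace.toDual_symm_apply]
    have hy : c⁻¹ • (InnerProductSpace.toDual ℝ (E n)).symm f ∈ M := by
      intro z hz
      rw [hf, inv_mul_le_one₀ hc0]
      exact (h1 z hz).le
    have h3 := inner_le_supportFnExt M hy x
    rw [hf] at h3
    rw [map_smul, smul_eq_mul, lt_inv_mul_iff₀ ha0] at h2
    have h4 : a < c⁻¹ * f x := by
      rw [lt_inv_mul_iff₀ hc0]
      linarith
    linarith

end PolarBody

/-! ### Existence and uniqueness of the Orlicz combination. -/

section OrliczCombination

variable {n : ℕ} {K L : ConvexBody (E n)} {φ₁ φ₂ : ℝ → ℝ}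

theorem MemPhi.pos {φ : ℝ → ℝ} (hφ : MemPhi φ) {t : ℝ} (ht : 0 < t) : 0 < φ t := by
  have := hφ.strictMonoOn (mem_Ici.2 le_rfl) (mem_Ici.2 ht.le) ht
  rwa [hφ.map_zero] at this

theorem MemPhi.convex_comp_supportFnExt {φ : ℝ → ℝ} (hφ : MemPhi φ) (hc : ConvexOn ℝ (Ici 0) φ)
    (hK : (0 : E n) ∈ interior (K : Set (E n))) :
    ConvexOn ℝ univ fun x => φ (supportFnExt K x) := by
  refine ⟨convex_univ, fun x _ y _ a b ha hb hab => ?_⟩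
  have hx := supportFnExt_nonneg K hK x
  have hy := supportFnExt_nonneg K hK y
  refine le_trans ?_ (hc.2 hx hy ha hb hab)
  refine hφ.strictMonoOn.monotoneOn (supportFnExt_nonneg K hK _)
    (mem_Ici.2 (add_nonneg (mul_nonneg ha hx) (mul_nonneg hb hy))) ?_
  have := supportFnExt_add_le K (a • x) (b • y)
  rwa [supportFnExt_smul K ha, supportFnExt_smul K hb] at this

theorem MemPhi.continuous_comp_supportFnExt {φ : ℝ → ℝ} (hφ : MemPhi φ)
    (hK : (0 : E n) ∈ interior (K : Set (E n))) :
    Continuous fun x => φ (supportFnExt K x) :=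
  hφ.continuousOn.comp_continuous (continuous_supportFnExt K) fun x => supportFnExt_nonneg K hK x

theorem supportFnExt_zero (K : ConvexBody (E n)) : supportFnExt K 0 = 0 := by
  simpa using supportFnExt_smul K le_rfl (0 : E n)

/-- An increasing convex function of a sublinear one is convex, so `{ψ ≤ 1}` is a convex body around
the origin. For its polar `M`, the point `u / h_M(u)` has gauge `1`, hence is a frontier point,
where `ψ = 1`. -/
theorem exists_isOrliczCombination (hK : (0 : E n) ∈ interior (K : Set (E n)))
    (hL : (0 : E n) ∈ interior (L : Set (E n))) (hφ₁ : MemPhi φ₁) (hφ₂ : MemPhi φ₂)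
    (hc₁ : ConvexOn ℝ (Ici 0) φ₁) (hc₂ : ConvexOn ℝ (Ici 0) φ₂) (h1 : φ₁ 1 = 1)
    {ε : ℝ} (hε : 0 < ε) : ∃ M, IsOrliczCombination φ₁ φ₂ ε K L M := by
  set ψ : E n → ℝ := fun x => φ₁ (supportFnExt K x) + ε * φ₂ (supportFnExt L x) with hψ
  have hψc : Continuous ψ := (hφ₁.continuous_comp_supportFnExt hK).add
    (continuous_const.mul (hφ₂.continuous_comp_supportFnExt hL))
  have hψconv : ConvexOn ℝ univ ψ := (hφ₁.convex_comp_supportFnExt hc₁ hK).add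
    ((hφ₂.convex_comp_supportFnExt hc₂ hL).smul hε.le)
  have hD : Convex ℝ {x | ψ x ≤ 1} := by simpa using hψconv.convex_le 1
  have hψ0 : ψ 0 = 0 := by
    simp [hψ, supportFnExt_zero, hφ₁.map_zero, hφ₂.map_zero]
  have hD0 : {x | ψ x ≤ 1} ∈ 𝓝 (0 : E n) :=
    (hψc.tendsto 0).eventually (Iic_mem_nhds (by rw [hψ0]; exact one_pos))
  have hDb : Bornology.IsBounded {x | ψ x ≤ 1} := by
    obtain ⟨r, hr, h⟩ := exists_forall_mul_norm_le_supportFnExt K hK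
    refine isBounded_iff_forall_norm_le.2 ⟨1 / r, fun x hx => ?_⟩
    have h2 : 0 ≤ ε * φ₂ (supportFnExt L x) :=
      mul_nonneg hε.le (hφ₂.mapsTo (supportFnExt_nonneg L hL x))
    have h3 : φ₁ (supportFnExt K x) ≤ φ₁ 1 := by
      rw [h1]
      have : φ₁ (supportFnExt K x) + ε * φ₂ (supportFnExt L x) ≤ 1 := hx
      linarith
    have h4 := (hφ₁.strictMonoOn.le_iff_le (supportFnExt_nonneg K hK x)
      (mem_Ici.2 zero_le_one)).1 h3
    rw [le_div_iff₀ hr]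
    linarith [h x]
  obtain ⟨M, hM0, hM⟩ := exists_supportFnExt_eq_gauge hD
    (isClosed_le hψc continuous_const) hD0 hDb
  refine ⟨M, hM0, fun u => ?_⟩
  set c := supportFn M u with hcdef
  have hc0 : 0 < c := supportFn_pos M hM0 u
  have hgauge : gauge {x | ψ x ≤ 1} (c⁻¹ • (u : E n)) = 1 := by
    rw [gauge_smul_of_nonneg (inv_pos.2 hc0).le, ← hM]
    exact inv_mul_cancel₀ hc0.ne'
  have hfr := frontier_le_subset_eq hψc continuous_const
    ((gauge_eq_one_iff_mem_frontier hD hD0).1 hgauge)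
  simp only [mem_ofPred_eq, hψ, supportFnExt_smul _ (inv_pos.2 hc0).le] at hfr
  rw [div_eq_inv_mul, div_eq_inv_mul]
  exact hfr

/-- For each `u` the left side of the defining equation is strictly decreasing in the value of
`h_M(u)`. -/
theorem IsOrliczCombination.unique (hK : (0 : E n) ∈ interior (K : Set (E n)))
    (hL : (0 : E n) ∈ interior (L : Set (E n))) (hφ₁ : MemPhi φ₁) (hφ₂ : MemPhi φ₂)
    {ε : ℝ} (hε : 0 < ε) {M N : ConvexBody (E n)} (hM : IsOrliczCombination φ₁ φ₂ ε K L M)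
    (hN : IsOrliczCombination φ₁ φ₂ ε K L N) : M = N := by
  have key : ∀ u (a b : ℝ), 0 < a → a < b →
      φ₁ (supportFn K u / b) + ε * φ₂ (supportFn L u / b) <
        φ₁ (supportFn K u / a) + ε * φ₂ (supportFn L u / a) := by
    intro u a b ha hab
    have hk := supportFn_pos K hK u
    have hl := supportFn_pos L hL u
    have hb := ha.trans hab
    refine add_lt_add (hφ₁.strictMonoOn (div_pos hk hb).le (div_pos hk ha).le ?_)
      (mul_lt_mul_of_pos_left (hφ₂.strictMonoOn (div_pos hl hb).le (div_pos hl ha).le ?_) hε)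
    · exact div_lt_div_of_pos_left hk ha hab
    · exact div_lt_div_of_pos_left hl ha hab
  refine eq_of_supportFn_eq (funext fun u => ?_)
  rcases lt_trichotomy (supportFn M u) (supportFn N u) with h | h | h
  · have := key u _ _ (supportFn_pos M hM.1 u) h
    rw [hM.2 u, hN.2 u] at this
    exact absurd this (lt_irrefl _)
  · exact h
  · have := key u _ _ (supportFn_pos N hN.1 u) h
    rw [hM.2 u, hN.2 u] at this
    exact absurd this (lt_irrefl _)

end OrliczCombination

/-! ### The one-variable limit. -/

section OneVariable

variable {φ₁ φ₂ : ℝ → ℝ}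

/-- The chord of `φ₁` from `0` to `1` has slope `1`, and chords ending at `1` are no steeper than
the left derivative there. -/
theorem one_le_leftDeriv (hφ₁ : MemPhi φ₁) (hc₁ : ConvexOn ℝ (Ici 0) φ₁) (h1 : φ₁ 1 = 1) :
    1 ≤ leftDeriv φ₁ 1 := by
  have h := hc₁.slope_le_leftDeriv_of_mem_interior (x := 0) (y := 1) (mem_Ici.2 le_rfl)
    (by rw [interior_Ici]; exact one_pos (α := ℝ)) one_pos
  simpa [leftDeriv, slope_def_field, h1, hφ₁.map_zero] using h

theorem tendsto_slope_leftDeriv (hc₁ : ConvexOn ℝ (Ici 0) φ₁) (h1 : φ₁ 1 = 1) :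
    Tendsto (fun t => (φ₁ t - 1) / (t - 1)) (𝓝[<] 1) (𝓝 (leftDeriv φ₁ 1)) := by
  have h := (hc₁.differentiableWithinAt_Iio_of_mem_interior (x := 1)
    (by rw [interior_Ici]; exact one_pos (α := ℝ))).hasDerivWithinAt
  rw [hasDerivWithinAt_iff_tendsto_slope' self_notMem_Iio] at h
  refine h.congr fun t => ?_
  rw [slope_def_field, h1]

/-- The bounds for a solution `c` of `φ₁(a / c) + ε φ₂(b / c) = 1`. -/
theorem orlicz_solution_bounds (hφ₁ : MemPhi φ₁) (hφ₂ : MemPhi φ₂)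
    (hc₁ : ConvexOn ℝ (Ici 0) φ₁) (h1 : φ₁ 1 = 1) {a b c ε : ℝ} (ha : 0 < a) (hb : 0 < b)
    (hc : 0 < c) (hε : 0 < ε) (h : φ₁ (a / c) + ε * φ₂ (b / c) = 1) :
    a / c < 1 ∧ 1 - a / c ≤ ε * φ₂ (b / a) := by
  have hac : 0 < a / c := div_pos ha hc
  have hbc : 0 < b / c := div_pos hb hc
  have hlt : a / c < 1 := by
    have : φ₁ (a / c) < φ₁ 1 := by
      rw [h1]
      have := mul_pos hε (hφ₂.pos hbc)
      linarith
    exact (hφ₁.strictMonoOn.lt_iff_lt hac.le (mem_Ici.2 zero_le_one)).1 this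
  refine ⟨hlt, ?_⟩
  -- The graph of `φ₁` lies below its chord from `(0, 0)` to `(1, 1)`.
  have hle : φ₁ (a / c) ≤ a / c := by
    have := hc₁.2 (mem_Ici.2 (zero_le_one (α := ℝ))) (mem_Ici.2 (le_refl (0 : ℝ))) hac.le
      (sub_nonneg.2 hlt.le) (by ring)
    simpa [h1, hφ₁.map_zero] using this
  have hmono : φ₂ (b / c) ≤ φ₂ (b / a) := by
    refine hφ₂.strictMonoOn.monotoneOn hbc.le (div_pos hb ha).le ?_
    exact div_le_div_of_nonneg_left hb.le ha ((div_lt_one hc).1 hlt).le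
  nlinarith

theorem rpow_mul_rpow_one_sub {a c : ℝ} (ha : 0 < a) (hc : 0 < c) (s : ℝ) :
    c ^ s * a ^ (1 - s) = a * (a / c) ^ (-s) := by
  rw [Real.div_rpow ha.le hc.le, Real.rpow_sub ha, Real.rpow_one, Real.rpow_neg ha.le,
    Real.rpow_neg hc.le]
  have h1 := (Real.rpow_pos_of_pos ha s).ne'
  have h2 := (Real.rpow_pos_of_pos hc s).ne'
  field_simp

theorem hasDerivAt_rpow_neg_one (s : ℝ) : HasDerivAt (fun t : ℝ => t ^ (-s)) (-s) 1 := by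
  simpa using Real.hasDerivAt_rpow_const (x := 1) (p := -s) (Or.inl one_ne_zero)

/-- A linear bound near `1`, with constants independent of `u`, which supplies the dominating
function. -/
theorem exists_abs_rpow_neg_sub_one_le (s : ℝ) :
    ∃ C δ : ℝ, 0 ≤ C ∧ 0 < δ ∧ ∀ t : ℝ, |t - 1| < δ → |t ^ (-s) - 1| ≤ C * |t - 1| := by
  obtain ⟨C, hC, h⟩ := (hasDerivAt_rpow_neg_one s).isBigO_sub.exists_pos
  obtain ⟨δ, hδ, h'⟩ := Metric.eventually_nhds_iff.1 h.bound
  refine ⟨C, δ, hC.le, hδ, fun t ht => ?_⟩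
  simpa using h' (y := t) ht

theorem tendsto_orlicz_variation (hφ₁ : MemPhi φ₁) (hφ₂ : MemPhi φ₂)
    (hc₁ : ConvexOn ℝ (Ici 0) φ₁) (h1 : φ₁ 1 = 1) {a b s : ℝ} (ha : 0 < a) (hb : 0 < b)
    (hs : s ≠ 0) {c : ℝ → ℝ} (hc : ∀ ε, 0 < ε → 0 < c ε)
    (h : ∀ ε, 0 < ε → φ₁ (a / c ε) + ε * φ₂ (b / c ε) = 1) :
    Tendsto (fun ε => (c ε ^ s * a ^ (1 - s) - a) / (s * ε)) (𝓝[>] 0)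
      (𝓝 (φ₂ (b / a) * a / leftDeriv φ₁ 1)) := by
  have hd : leftDeriv φ₁ 1 ≠ 0 := (one_pos.trans_le (one_le_leftDeriv hφ₁ hc₁ h1)).ne'
  have hbound := fun ε (hε : 0 < ε) =>
    orlicz_solution_bounds hφ₁ hφ₂ hc₁ h1 ha hb (hc ε hε) hε (h ε hε)
  have ht1 : Tendsto (fun ε => a / c ε) (𝓝[>] 0) (𝓝 1) := by
    have hlow : Tendsto (fun ε : ℝ => 1 - ε * φ₂ (b / a)) (𝓝[>] 0) (𝓝 1) := by
      have : Continuous fun ε : ℝ => 1 - ε * φ₂ (b / a) := by fun_prop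
      simpa using (this.tendsto 0).mono_left nhdsWithin_le_nhds
    refine tendsto_of_tendsto_of_tendsto_of_le_of_le' hlow tendsto_const_nhds ?_ ?_
    · filter_upwards [self_mem_nhdsWithin] with ε hε
      linarith [(hbound ε hε).2]
    · filter_upwards [self_mem_nhdsWithin] with ε hε using (hbound ε hε).1.le
  have ht : Tendsto (fun ε => a / c ε) (𝓝[>] 0) (𝓝[<] 1) := by
    refine tendsto_nhdsWithin_iff.2 ⟨ht1, ?_⟩
    filter_upwards [self_mem_nhdsWithin] with ε hε using (hbound ε hε).1
  have hslope₁ := (tendsto_slope_leftDeriv hc₁ h1).comp ht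
  have hslope₂ : Tendsto (fun t : ℝ => (t ^ (-s) - 1) / (t - 1)) (𝓝[<] 1) (𝓝 (-s)) := by
    have := (hasDerivAt_rpow_neg_one s).hasDerivWithinAt (s := Iio 1)
    rw [hasDerivWithinAt_iff_tendsto_slope' self_notMem_Iio] at this
    refine this.congr fun t => ?_
    rw [slope_def_field, Real.one_rpow]
  have hφ : Tendsto (fun ε => φ₂ (b / c ε)) (𝓝[>] 0) (𝓝 (φ₂ (b / a))) := by
    have hcont : ContinuousAt φ₂ (b / a) :=
      hφ₂.continuousOn.continuousAt (Ici_mem_nhds (div_pos hb ha))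
    refine hcont.tendsto.comp ?_
    have := ht1.const_mul (b / a)
    rw [mul_one] at this
    refine this.congr fun ε => ?_
    field_simp
  -- The quotient is factored through `t - 1`, with `φ₁(t) - 1 = -ε φ₂(b / c)` absorbing the factor
  -- `ε`.
  have hlim := ((((hslope₂.comp ht).mul hφ).div hslope₁ hd).const_mul (-a / s))
  have e : -a / s * (-s * φ₂ (b / a) / leftDeriv φ₁ 1) = φ₂ (b / a) * a / leftDeriv φ₁ 1 := by
    field_simp
  rw [e] at hlim
  refine hlim.congr' ?_
  filter_upwards [self_mem_nhdsWithin] with ε hε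
  have hε' : (0 : ℝ) < ε := hε
  have hlt := (hbound ε hε').1
  have hφpos := hφ₂.pos (div_pos hb (hc ε hε'))
  have heq : φ₁ (a / c ε) - 1 = -(ε * φ₂ (b / c ε)) := by linarith [h ε hε']
  rw [rpow_mul_rpow_one_sub ha (hc ε hε') s]
  simp only [Function.comp_apply, Pi.div_apply]
  rw [heq]
  have ht0 : a / c ε - 1 ≠ 0 := (sub_neg.2 hlt).ne
  generalize a / c ε = t at ht0 ⊢
  generalize φ₂ (b / c ε) = w at hφpos ⊢
  have := hφpos.ne'
  have := hε'.ne'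
  field_simp

end OneVariable

/-! ### Passing to the limit under the integral. -/

section Variation

variable {n : ℕ} {K L : ConvexBody (E n)} {φ₁ φ₂ : ℝ → ℝ}

theorem MemPhi.continuous_comp_supportFn_div {φ : ℝ → ℝ} (hφ : MemPhi φ)
    (hK : (0 : E n) ∈ interior (K : Set (E n))) (hL : (0 : E n) ∈ interior (L : Set (E n))) :
    Continuous fun u => φ (supportFn L u / supportFn K u) :=
  hφ.continuousOn.comp_continuous
    ((continuous_supportFn L).div (continuous_supportFn K) fun u => (supportFn_pos K hK u).ne')
    fun u => (div_pos (supportFn_pos L hL u) (supportFn_pos K hK u)).le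

theorem continuous_orliczIntegrand {φ : ℝ → ℝ} (hφ : MemPhi φ)
    (hK : (0 : E n) ∈ interior (K : Set (E n))) (hL : (0 : E n) ∈ interior (L : Set (E n))) :
    Continuous (orliczIntegrand φ K L) :=
  (hφ.continuous_comp_supportFn_div hK hL).mul (continuous_supportFn K)

theorem continuous_mixedIntegrand (s : ℝ) (hK : (0 : E n) ∈ interior (K : Set (E n)))
    (hL : (0 : E n) ∈ interior (L : Set (E n))) : Continuous (mixedIntegrand s K L) :=
  ((continuous_supportFn L).rpow_const fun u => Or.inl (supportFn_pos L hL u).ne').mul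
    ((continuous_supportFn K).rpow_const fun u => Or.inl (supportFn_pos K hK u).ne')

theorem integrable_surfaceAreaMeasure (hn : 1 ≤ n) (hK : (0 : E n) ∈ interior (K : Set (E n)))
    {f : USphere n → ℝ} (hf : Continuous f) : Integrable f (surfaceAreaMeasure K) := by
  have := isFiniteMeasure_surfaceAreaMeasure hn hK
  exact hf.integrable_of_hasCompactSupport (HasCompactSupport.of_compactSpace f)

theorem tendsto_integral_orlicz_variation (hn : 1 ≤ n)
    (hK : (0 : E n) ∈ interior (K : Set (E n))) (hL : (0 : E n) ∈ interior (L : Set (E n)))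
    (hφ₁ : MemPhi φ₁) (hφ₂ : MemPhi φ₂) (hc₁ : ConvexOn ℝ (Ici 0) φ₁) (h1 : φ₁ 1 = 1)
    {s : ℝ} (hs : s ≠ 0) {M : ℝ → ConvexBody (E n)}
    (hM : ∀ ε : ℝ, 0 < ε → IsOrliczCombination φ₁ φ₂ ε K L (M ε)) :
    Tendsto (fun ε => ∫ u, (mixedIntegrand s K (M ε) u - supportFn K u) / (s * ε)
      ∂(surfaceAreaMeasure K)) (𝓝[>] 0)
      (𝓝 (∫ u, orliczIntegrand φ₂ K L u / leftDeriv φ₁ 1 ∂(surfaceAreaMeasure K))) := by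
  obtain ⟨C, δ, hC, hδ, hCδ⟩ := exists_abs_rpow_neg_sub_one_le s
  obtain ⟨B, hB⟩ := isCompact_univ.exists_bound_of_continuousOn
    (hφ₂.continuous_comp_supportFn_div hK hL).continuousOn
  set Φ := max B 1
  have hΦ0 : 0 < Φ := lt_max_of_lt_right one_pos
  have hΦ : ∀ u, φ₂ (supportFn L u / supportFn K u) ≤ Φ := fun u =>
    (le_abs_self _).trans ((hB u (mem_univ u)).trans (le_max_left _ _))
  have hMint : ∀ ε, 0 < ε → (0 : E n) ∈ interior (M ε : Set (E n)) := fun ε hε => (hM ε hε).1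
  -- This brings the ratio `h_K / h_M` within `δ` of `1` for all `u` at once, since `|h_K / h_M - 1|
  -- ≤ ε Φ`.
  have hsmall : ∀ᶠ ε : ℝ in 𝓝[>] 0, ε * Φ < δ := by
    have hc : Continuous fun ε : ℝ => ε * Φ := by fun_prop
    exact ((hc.tendsto 0).mono_left nhdsWithin_le_nhds).eventually
      (Iio_mem_nhds (by rwa [zero_mul]))
  refine tendsto_integral_filter_of_dominated_convergence
    (fun u => supportFn K u * (C * Φ / |s|)) ?_ ?_ ?_ ?_
  · filter_upwards [self_mem_nhdsWithin] with ε hε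
    exact (((continuous_mixedIntegrand s hK (hMint ε hε)).sub
      (continuous_supportFn K)).div_const _).aestronglyMeasurable
  · filter_upwards [self_mem_nhdsWithin, hsmall] with ε hε hεδ
    refine Eventually.of_forall fun u => ?_
    have hε' : (0 : ℝ) < ε := hε
    have hk := supportFn_pos K hK u
    have hm := supportFn_pos (M ε) (hMint ε hε') u
    obtain ⟨b1, b2⟩ := orlicz_solution_bounds hφ₁ hφ₂ hc₁ h1 hk (supportFn_pos L hL u) hm hε'
      ((hM ε hε').2 u)
    have b3 : |supportFn K u / supportFn (M ε) u - 1| ≤ ε * Φ := by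
      rw [abs_sub_comm, abs_of_pos (sub_pos.2 b1)]
      exact b2.trans (mul_le_mul_of_nonneg_left (hΦ u) hε'.le)
    have b4 := (hCδ _ (b3.trans_lt hεδ)).trans (mul_le_mul_of_nonneg_left b3 hC)
    rw [mixedIntegrand, rpow_mul_rpow_one_sub hk hm, Real.norm_eq_abs, abs_div, abs_mul,
      abs_of_pos hε', ← mul_sub_one, abs_mul, abs_of_pos hk, mul_div_assoc]
    refine mul_le_mul_of_nonneg_left ?_ hk.le
    have hs' : 0 < |s| := abs_pos.2 hs
    rw [div_le_iff₀ (mul_pos hs' hε')]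
    refine b4.trans (le_of_eq ?_)
    field_simp
  · exact integrable_surfaceAreaMeasure hn hK ((continuous_supportFn K).mul continuous_const)
  · refine Eventually.of_forall fun u => ?_
    exact tendsto_orlicz_variation hφ₁ hφ₂ hc₁ h1 (supportFn_pos K hK u) (supportFn_pos L hL u) hs
      (fun ε hε => supportFn_pos (M ε) (hMint ε hε) u) fun ε hε => (hM ε hε).2 u

end Variation

/-! ### The main theorem. -/

theorem mainTheorem12 (n : ℕ) (hn : 1 ≤ n) (K L : ConvexBody (E n))
    (hK : (0 : E n) ∈ interior (K : Set (E n))) (hL : (0 : E n) ∈ interior (L : Set (E n)))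
    (φ₁ φ₂ : ℝ → ℝ) (hφ₁ : MemPhi φ₁) (hφ₂ : MemPhi φ₂)
    (hc₁ : ConvexOn ℝ (Ici 0) φ₁) (hc₂ : ConvexOn ℝ (Ici 0) φ₂)
    (h1 : φ₁ 1 = 1) (h2 : φ₂ 1 = 1) (s : ℝ) (hs : s ≠ 0) :
    -- the left derivative of `φ₁` at `1` exists and is positive
    DifferentiableWithinAt ℝ φ₁ (Iio 1) 1 ∧ 0 < leftDeriv φ₁ 1 ∧
    -- the body `K +_{φ,ε} L` is well defined
    (∀ ε : ℝ, 0 < ε → ∃! M : ConvexBody (E n), IsOrliczCombination φ₁ φ₂ ε K L M) ∧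
    -- the integral that defines `V_{φ₂}(K, L)` converges
    Integrable (orliczIntegrand φ₂ K L) (surfaceAreaMeasure K) ∧
    ∀ M : ℝ → ConvexBody (E n), (∀ ε : ℝ, 0 < ε → IsOrliczCombination φ₁ φ₂ ε K L (M ε)) →
      (∀ ε : ℝ, 0 < ε → Integrable (mixedIntegrand s K (M ε)) (surfaceAreaMeasure K)) ∧
      ∃ l : ℝ,
        Tendsto (fun ε : ℝ => (mixedVolume s K (M ε) - bodyVolume K) / (s * ε))
          (𝓝[>] 0) (𝓝 l) ∧
        leftDeriv φ₁ 1 * l = orliczMixedVolume φ₂ K L := by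
  have hd := one_pos.trans_le (one_le_leftDeriv hφ₁ hc₁ h1)
  refine ⟨hc₁.differentiableWithinAt_Iio_of_mem_interior
    (by rw [interior_Ici]; exact one_pos (α := ℝ)), hd, fun ε hε => ?_,
    integrable_surfaceAreaMeasure hn hK (continuous_orliczIntegrand hφ₂ hK hL), fun M hM => ?_⟩
  · obtain ⟨M, hM⟩ := exists_isOrliczCombination hK hL hφ₁ hφ₂ hc₁ hc₂ h1 hε
    exact ⟨M, hM, fun N hN => hN.unique hK hL hφ₁ hφ₂ hε hM⟩
  have hint : ∀ ε : ℝ, 0 < ε → Integrable (mixedIntegrand s K (M ε)) (surfaceAreaMeasure K) :=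
    fun ε hε => integrable_surfaceAreaMeasure hn hK (continuous_mixedIntegrand s hK (hM ε hε).1)
  refine ⟨hint, (1 / (n : ℝ)) *
    ∫ u, orliczIntegrand φ₂ K L u / leftDeriv φ₁ 1 ∂(surfaceAreaMeasure K), ?_, ?_⟩
  · refine ((tendsto_integral_orlicz_variation hn hK hL hφ₁ hφ₂ hc₁ h1 hs hM).const_mul
      (1 / (n : ℝ))).congr' ?_
    filter_upwards [self_mem_nhdsWithin] with ε hε
    rw [integral_div, integral_sub (hint ε hε)
      (integrable_surfaceAreaMeasure hn hK (continuous_supportFn K)), mixedVolume,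
      bodyVolume_eq_integral_supportFn hn hK]
    ring
  · rw [integral_div, orliczMixedVolume]
    field_simp
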